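/- Let $K$ be an algebraically closed field of characteristic zero, let $\mathbb{P}^1=\mathrm{Proj}\,K[x_0,x_1]$ be the projective line over $K$, and let $\mathcal{O}(d)$, $d\in\mathbb{Z}$, be Serre's twisting sheaves on it. Let $\mathrm{K}(\mathbb{P}^1)$ be the Grothendieck group of locally free sheaves of finite rank on $\mathbb{P}^1$, i.e. the abelian group generated by symbols $[\mathcal{E}]$, one for each such sheaf $\mathcal{E}$, with relations $[\mathcal{E}]=[\mathcal{E}']+[\mathcal{E}'']$ for every short exact sequence $0\to\mathcal{E}'\to\mathcal{E}\to\mathcal{E}''\to 0$ of locally free sheaves of finite rank. For $\mathcal{E}\cong\mathcal{O}(d_1)\oplus\cdots\oplus\mathcal{O}(d_e)$ put $\deg(\mathcal{E})=d_1+\cdots+d_e$. Then every sheaf $\mathcal{O}(d_1)\oplus\cdots\oplus\mathcal{O}(d_e)$ ($e\ge 0$, $d_i\in\mathbb{Z}$) is locally free of rank $e$, and there is a unique isomorphism of abelian groups $$\phi:\mathrm{K}(\mathbb{P}^1)\xrightarrow{\ \cong\ }\mathbb{Z}\oplus\mathbb{Z}$$ such that $$\phi([\mathcal{E}])=(\deg(\mathcal{E}),\mathrm{rk}(\mathcal{E}))$$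 for every locally free sheaf $\mathcal{E}$ isomorphic to some $\mathcal{O}(d_1)\oplus\cdots\oplus\mathcal{O}(d_e)$, where $\mathrm{rk}(\mathcal{E})$ is the rank of $\mathcal{E}$, and such that the second component of $\phi([\mathcal{E}])$ is $\mathrm{rk}(\mathcal{E})$ for every locally free sheaf $\mathcal{E}$ of constant finite rank $\mathrm{rk}(\mathcal{E})$. -/

import Mathlib

universe u

open CategoryTheory Limits AlgebraicGeometry TopologicalSpace Opposite

noncomputable section

namespace KTheoryP1

/-! ### Vector bundles on a scheme and their Grothendieck group -/

/-- The `𝒪_X`-module `M` is free of rank `r` on some open neighbourhood of the point `x`. -/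
def HasRankAt {X : Scheme.{u}} (M : X.Modules) (x : X) (r : ℕ) : Prop :=
  ∃ U : X.Opens, x ∈ U ∧
    Nonempty (M.restrict U.ι ≅
      (SheafOfModules.free (R := (U : Scheme.{u}).ringCatSheaf) (ULift.{u} (Fin r)) :
        (U : Scheme.{u}).Modules))

/-- `M` is a locally free sheaf of finite rank: near every point it is free of some finite rank. -/
def IsLocallyFreeFiniteRank {X : Scheme.{u}} (M : X.Modules) : Prop :=
  ∀ x : X, ∃ r : ℕ, HasRankAt M x r

/-- `M` is a locally free sheaf of constant rank `r`. -/
def HasRank {X : Scheme.{u}} (M : X.Modules) (r : ℕ) : Prop :=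
  ∀ x : X, HasRankAt M x r

/-- The locally free sheaves of finite rank on `X`. -/
structure VectorBundle (X : Scheme.{u}) where
  /-- the underlying sheaf of modules -/
  sheaf : X.Modules
  isLocallyFree : IsLocallyFreeFiniteRank sheaf

/-- The subgroup of the free abelian group on the vector bundles that is generated by the elements
`[E] - [E'] - [E'']`, one for each short exact sequence `0 ⟶ E' ⟶ E ⟶ E'' ⟶ 0`. -/
def exactRelations (X : Scheme.{u}) : AddSubgroup (FreeAbelianGroup (VectorBundle X)) :=
  AddSubgroup.closure
    {z | ∃ (E' E E'' : VectorBundle X) (i : E'.sheaf ⟶ E.sheaf) (p : E.sheaf ⟶ E''.sheaf)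
        (w : i ≫ p = 0), (ShortComplex.mk i p w).ShortExact ∧
        z = FreeAbelianGroup.of E - FreeAbelianGroup.of E' - FreeAbelianGroup.of E''}

/-- The Grothendieck group `K(X)` of locally free sheaves of finite rank on `X`. -/
abbrev KGroup (X : Scheme.{u}) : Type (u + 1) :=
  FreeAbelianGroup (VectorBundle X) ⧸ exactRelations X

/-- The class `[E]` in `K(X)`. -/
def KGroup.of {X : Scheme.{u}} (E : VectorBundle X) : KGroup X :=
  QuotientAddGroup.mk (FreeAbelianGroup.of E)

/-! ### The twisting sheaves on `Proj` -/

section Twist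

variable {A σ : Type u} [CommRing A] [SetLike σ A] [AddSubgroupClass σ A]
variable (𝒜 : ℕ → σ) [GradedRing 𝒜] (d : ℤ)

/-- The elements of `A` outside the homogeneous prime `x`. -/
abbrev complAt (x : ProjectiveSpectrum 𝒜) : Submonoid A :=
  x.asHomogeneousIdeal.toIdeal.primeCompl

/-- The localization of the graded ring `A` at the homogeneous prime `x` (every element outside `x`
is inverted). -/
abbrev LocAt (x : ProjectiveSpectrum 𝒜) : Type u :=
  Localization (complAt 𝒜 x)

/-- On all of `U` the function `f` is one fraction `a / b` with `a`, `b` homogeneous and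
`deg a - deg b = d`. -/
def IsTwistFraction {U : Opens (ProjectiveSpectrum.top 𝒜)} (f : ∀ x : U, LocAt 𝒜 x.1) : Prop :=
  ∃ (i j : ℕ) (a : 𝒜 i) (b : 𝒜 j), (i : ℤ) - j = d ∧
    ∀ x : U, ∃ hb : (b : A) ∈ complAt 𝒜 x.1, f x = Localization.mk (a : A) ⟨b, hb⟩

/-- `IsTwistFraction` passes to smaller open sets. -/
def twistPrelocal : TopCat.PrelocalPredicate (X := ProjectiveSpectrum.top 𝒜) (LocAt 𝒜) where
  pred f := IsTwistFraction 𝒜 d f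
  res := by
    rintro V U i f ⟨m, n, a, b, h, w⟩
    exact ⟨m, n, a, b, h, fun x => w (i x)⟩

/-- Functions that locally are fractions of degree `d`. -/
def twistLocal : TopCat.LocalPredicate (X := ProjectiveSpectrum.top 𝒜) (LocAt 𝒜) :=
  (twistPrelocal 𝒜 d).sheafify

theorem exists_homogeneous_mem_complAt (x : ProjectiveSpectrum 𝒜) :
    ∃ (i j : ℕ) (b : 𝒜 j), (i : ℤ) - j = d ∧ (b : A) ∈ complAt 𝒜 x := by
  obtain ⟨n, hn, c, hc, hcx⟩ : ∃ n : ℕ, 0 < n ∧ ∃ c ∈ 𝒜 n, c ∈ complAt 𝒜 x := by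
    by_contra! H
    refine x.not_irrelevant_le fun r hr => ?_
    classical
    rw [← DirectSum.sum_support_decompose 𝒜 r]
    refine sum_mem fun k _ => ?_
    rcases Nat.eq_zero_or_pos k with rfl | hk
    · have h0 : ((DirectSum.decompose 𝒜 r 0 : 𝒜 0) : A) = 0 := by
        simpa [HomogeneousIdeal.mem_irrelevant_iff, GradedRing.proj_apply] using hr
      rw [h0]
      exact zero_mem _
    · by_contra hx
      exact H k hk _ (SetLike.coe_mem _) hx
  refine ⟨(((n * d.natAbs : ℕ) : ℤ) + d).toNat, d.natAbs * n,
    ⟨c ^ d.natAbs, SetLike.pow_mem_graded _ hc⟩, ?_, pow_mem hcx _⟩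
  have h1 : d.natAbs ≤ n * d.natAbs := Nat.le_mul_of_pos_left _ hn
  rw [mul_comm d.natAbs n]
  omega

theorem twist_zero_mem (U : Opens (ProjectiveSpectrum.top 𝒜)) :
    (twistLocal 𝒜 d).pred (fun x : U => (0 : LocAt 𝒜 x.1)) := by
  intro x
  obtain ⟨i, j, b, h, hb⟩ := exists_homogeneous_mem_complAt 𝒜 d x.1
  refine ⟨U ⊓ ProjectiveSpectrum.basicOpen 𝒜 (b : A), ⟨x.2, hb⟩, homOfLE inf_le_left,
    i, j, 0, b, h, fun y => ⟨y.2.2, ?_⟩⟩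
  simp [Localization.mk_zero]

theorem twist_add_mem (U : Opens (ProjectiveSpectrum.top 𝒜)) (f g : ∀ x : U, LocAt 𝒜 x.1)
    (hf : (twistLocal 𝒜 d).pred f) (hg : (twistLocal 𝒜 d).pred g) :
    (twistLocal 𝒜 d).pred (fun x => f x + g x) := by
  intro x
  obtain ⟨V, hxV, iV, m, n, a, b, h, w⟩ := hf x
  obtain ⟨V', hxV', iV', m', n', a', b', h', w'⟩ := hg x
  refine ⟨V ⊓ V', ⟨hxV, hxV'⟩, homOfLE inf_le_left ≫ iV, m + n', n + n',
    ⟨(b' : A) * a + b * a', add_mem ?_ ?_⟩, ⟨(b : A) * b', SetLike.mul_mem_graded b.2 b'.2⟩,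
    by push_cast; omega, fun y => ?_⟩
  · rw [add_comm m n']
    exact SetLike.mul_mem_graded b'.2 a.2
  · rw [show m + n' = n + m' by omega]
    exact SetLike.mul_mem_graded b.2 a'.2
  · obtain ⟨hb, e⟩ := w ⟨y.1, y.2.1⟩
    obtain ⟨hb', e'⟩ := w' ⟨y.1, y.2.2⟩
    refine ⟨mul_mem hb hb', (congrArg₂ (· + ·) e e').trans ?_⟩
    simp only [Localization.add_mk]
    congr 1
    simp [add_comm]

theorem twist_neg_mem (U : Opens (ProjectiveSpectrum.top 𝒜)) (f : ∀ x : U, LocAt 𝒜 x.1)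
    (hf : (twistLocal 𝒜 d).pred f) : (twistLocal 𝒜 d).pred (fun x => -f x) := by
  intro x
  obtain ⟨V, hxV, iV, m, n, a, b, h, w⟩ := hf x
  refine ⟨V, hxV, iV, m, n, -a, b, h, fun y => ?_⟩
  obtain ⟨hb, e⟩ := w y
  exact ⟨hb, (congrArg (- ·) e).trans (by simp [Localization.neg_mk])⟩

/-- Pointwise multiplication by a section of the structure sheaf preserves degree `d`. -/
theorem twist_smul_mem (U : Opens (ProjectiveSpectrum.top 𝒜))
    (s : (ProjectiveSpectrum.Proj.structureSheaf 𝒜).1.obj (op U)) (f : ∀ x : U, LocAt 𝒜 x.1)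
    (hf : (twistLocal 𝒜 d).pred f) :
    (twistLocal 𝒜 d).pred (fun x => (s.1 x).val * f x) := by
  intro x
  obtain ⟨V, hxV, iV, n, a, b, hb, w⟩ := s.2 x
  obtain ⟨V', hxV', iV', m', n', a', b', h', w'⟩ := hf x
  refine ⟨V ⊓ V', ⟨hxV, hxV'⟩, homOfLE inf_le_left ≫ iV, n + m', n + n',
    ⟨(a : A) * a', SetLike.mul_mem_graded a.2 a'.2⟩,
    ⟨(b : A) * b', SetLike.mul_mem_graded b.2 b'.2⟩, by push_cast; omega, fun y => ?_⟩
  have e := w ⟨y.1, y.2.1⟩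
  obtain ⟨hb', e'⟩ := w' ⟨y.1, y.2.2⟩
  refine ⟨mul_mem (hb ⟨y.1, y.2.1⟩) hb',
    (congrArg₂ (· * ·) (congrArg HomogeneousLocalization.val e) e').trans ?_⟩
  rw [HomogeneousLocalization.val_mk, Localization.mk_mul]
  rfl

/-- The sections of `𝒪(d)` over `U`: the functions sending `x ∈ U` to an element of the
localization of `A` at `x` which locally are fractions of degree `d`. -/
def twistSections (U : Opens (ProjectiveSpectrum.top 𝒜)) :
    AddSubgroup (∀ x : U, LocAt 𝒜 x.1) where
  carrier := {f | (twistLocal 𝒜 d).pred f}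
  zero_mem' := twist_zero_mem 𝒜 d U
  add_mem' := twist_add_mem 𝒜 d U _ _
  neg_mem' := twist_neg_mem 𝒜 d U _

/-- The sections of `𝒪(d)` over `U` form a module over the sections of the structure sheaf. -/
instance twistModule (U : (Opens (ProjectiveSpectrum.top 𝒜))ᵒᵖ) :
    Module ((ProjectiveSpectrum.Proj.structureSheaf 𝒜).1.obj U) (twistSections 𝒜 d U.unop) where
  smul s f := ⟨fun x => (s.1 x).val * f.1 x, twist_smul_mem 𝒜 d U.unop s f.1 f.2⟩
  one_smul f := Subtype.ext <| funext fun x =>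
    (congrArg (· * f.1 x) HomogeneousLocalization.val_one).trans (one_mul _)
  mul_smul _ _ f := Subtype.ext <| funext fun x =>
    (congrArg (· * f.1 x) (HomogeneousLocalization.val_mul _ _)).trans (mul_assoc _ _ _)
  smul_zero _ := Subtype.ext <| funext fun _ => mul_zero _
  smul_add _ _ _ := Subtype.ext <| funext fun _ => mul_add _ _ _
  add_smul _ _ f := Subtype.ext <| funext fun x =>
    (congrArg (· * f.1 x) (HomogeneousLocalization.val_add _ _)).trans (add_mul _ _ _)
  zero_smul f := Subtype.ext <| funext fun x =>
    (congrArg (· * f.1 x) HomogeneousLocalization.val_zero).trans (zero_mul _)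

/-- The presheaf of abelian groups underlying `𝒪(d)`, with the restriction of functions. -/
def twistPresheafAb : TopCat.Presheaf Ab.{u} (ProjectiveSpectrum.top 𝒜) where
  obj U := AddCommGrpCat.of (twistSections 𝒜 d U.unop)
  map i := AddCommGrpCat.ofHom
    { toFun := (TopCat.subsheafToTypes (twistLocal 𝒜 d)).1.map i
      map_zero' := rfl
      map_add' _ _ := rfl }

/-- The presheaf of modules underlying `𝒪(d)`. -/
def twistPresheaf : (Proj 𝒜).PresheafOfModules :=
  letI (U : (Opens (Proj 𝒜))ᵒᵖ) :
    Module ((Proj 𝒜).ringCatSheaf.obj.obj U) ((twistPresheafAb 𝒜 d).obj U) :=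
    twistModule 𝒜 d U
  PresheafOfModules.ofPresheaf (R := (Proj 𝒜).ringCatSheaf.obj) (twistPresheafAb 𝒜 d)
    fun _ _ _ _ _ => rfl

/-- Serre's twisting sheaf `𝒪(d)` on `Proj A`: the sheaf associated with the graded module `A(d)`.
-/
def twist : (Proj 𝒜).Modules where
  val := twistPresheaf 𝒜 d
  isSheaf := (TopCat.Presheaf.isSheaf_iff_isSheaf_comp (forget AddCommGrpCat) _).2
    (TopCat.subsheafToTypes (twistLocal 𝒜 d)).2

end Twist

/-! ### The projective line -/

attribute [local instance] MvPolynomial.gradedAlgebra Abelian.hasFiniteBiproducts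

/-- The projective line over `K`, with homogeneous coordinate ring `K[x₀, x₁]`. -/
abbrev P1 (K : Type u) [Field K] : Scheme.{u} :=
  Proj (MvPolynomial.homogeneousSubmodule (Fin 2) K)

/-- The line bundle `𝒪(d)` on the projective line. -/
abbrev O (K : Type u) [Field K] (d : ℤ) : (P1 K).Modules :=
  twist (MvPolynomial.homogeneousSubmodule (Fin 2) K) d

/-- The split bundle `𝒪(d₁) ⊕ ⋯ ⊕ 𝒪(dₑ)` on the projective line. -/
abbrev splitBundle (K : Type u) [Field K] {e : ℕ} (d : Fin e → ℤ) : (P1 K).Modules :=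
  ⨁ fun i => O K (d i)

/-- `E` has degree `δ`: it is isomorphic to a split bundle `𝒪(d₁) ⊕ ⋯ ⊕ 𝒪(dₑ)` with
`d₁ + ⋯ + dₑ = δ`. -/
def HasDegree {K : Type u} [Field K] (E : (P1 K).Modules) (δ : ℤ) : Prop :=
  ∃ (e : ℕ) (d : Fin e → ℤ), Nonempty (E ≅ splitBundle K d) ∧ ∑ i, d i = δ

end KTheoryP1

end

/-! The line is covered by the charts `x₀ ≠ 0` and `x₁ ≠ 0`, whose rings of functions are polynomial
rings in `x₁ / x₀` and in `t = x₀ / x₁`; on the overlap the functions are the Laurent polynomials in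
`t`. Polynomial rings in one variable are principal ideal domains, so a vector bundle has a frame on
each chart and is described by an invertible matrix `g` over `K[t, t⁻¹]`. Its determinant is a unit,
hence `c t ^ δ` with `c ≠ 0`. Changing frames multiplies the determinant by units of polynomial
rings, that is, by constants, so `δ` is an invariant (`HasRankDegree.degree_eq`). It equals `∑ dᵢ`
for `⨁ 𝒪(dᵢ)`. In a short exact sequence the transition matrix is block triangular
(`HasRankDegree.add`), so `(δ, rank)` defines a homomorphism on the Grothendieck group.

For bijectivity no splitting theorem is needed. A bundle of positive rank contains some `𝒪(d)` with
locally free quotient (`exists_quotient`): a frame vector of one chart is, up to a unit on the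
overlap, a member of a suitable frame of the other chart. Hence the classes `[𝒪(d)]` generate, and a
line bundle has the class of `𝒪(δ)`. The embedding `(x₀, x₁)` of `𝒪(d)` in `𝒪(d + 1) ⊕ 𝒪(d + 1)` has
quotient of rank one and degree `d + 2`, so `[𝒪(d)] + [𝒪(d + 2)] = 2 [𝒪(d + 1)]`
(`lineBundle_relation`). The `[𝒪(d)]` thus form an arithmetic progression, and `[𝒪]`, `[𝒪(1)] - [𝒪]`
generate the group. Their images `(0, 1)` and `(1, 0)` form a basis of `ℤ × ℤ`. Uniqueness follows
because the values on the `[𝒪(d)]` are prescribed. -/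

noncomputable section

namespace KTheoryP1

attribute [local instance] Abelian.hasFiniteBiproducts

/-! ### Sections of sheaves of modules -/

section Sections

variable {X : Scheme.{u}} {M N P : X.Modules} {U V W : X.Opens}

/-- Restriction of sections of a sheaf of modules. -/
def rs (M : X.Modules) {U V : X.Opens} (h : V ≤ U) : Γ(M, U) →+ Γ(M, V) :=
  (M.presheaf.map (homOfLE h).op).hom

/-- Restriction of functions. -/
def ro {X : Scheme.{u}} {U V : X.Opens} (h : V ≤ U) : Γ(X, U) →+* Γ(X, V) :=
  (X.presheaf.map (homOfLE h).op).hom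

theorem rs_rs (h : V ≤ U) (h' : W ≤ V) (s : Γ(M, U)) :
    rs M h' (rs M h s) = rs M (h'.trans h) s := by
  simp only [rs]
  rw [← homOfLE_comp h' h, op_comp, Functor.map_comp]
  rfl

@[simp] theorem rs_self (h : U ≤ U) (s : Γ(M, U)) : rs M h s = s := by
  simp [rs]

theorem ro_ro (h : V ≤ U) (h' : W ≤ V) (s : Γ(X, U)) :
    ro h' (ro h s) = ro (h'.trans h) s := by
  simp only [ro]
  rw [← homOfLE_comp h' h, op_comp, Functor.map_comp]
  rfl

@[simp] theorem ro_self (h : U ≤ U) (s : Γ(X, U)) : ro h s = s := by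
  simp [ro]

theorem rs_smul (h : V ≤ U) (r : Γ(X, U)) (s : Γ(M, U)) :
    rs M h (r • s) = ro h r • rs M h s :=
  M.map_smul (homOfLE h) r s

theorem app_rs (φ : M ⟶ N) (h : V ≤ U) (s : Γ(M, U)) :
    φ.app V (rs M h s) = rs N h (φ.app U s) :=
  congr($(φ.mapPresheaf.naturality (homOfLE h).op) s)

theorem app_sum (φ : M ⟶ N) {ι : Type*} [Fintype ι] (a : ι → Γ(X, U)) (s : ι → Γ(M, U)) :
    φ.app U (∑ i, a i • s i) = ∑ i, a i • φ.app U (s i) := by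
  simp [map_sum]

theorem eq_of_locally {s t : Γ(M, U)}
    (h : ∀ x ∈ U, ∃ (V : X.Opens) (hV : V ≤ U), x ∈ V ∧ rs M hV s = rs M hV t) : s = t := by
  choose V hV hx e using h
  refine TopCat.Sheaf.eq_of_locally_eq' ⟨M.presheaf, M.isSheaf⟩ (fun x : U => V x.1 x.2) U
    (fun x => homOfLE (hV _ _)) (fun x hxU => Opens.mem_iSup.2 ⟨⟨x, hxU⟩, hx x hxU⟩) s t
    (fun x => e _ _)

theorem fun_eq_of_locally {s t : Γ(X, U)}
    (h : ∀ x ∈ U, ∃ (V : X.Opens) (hV : V ≤ U), x ∈ V ∧ ro hV s = ro hV t) : s = t := by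
  choose V hV hx e using h
  refine TopCat.Sheaf.eq_of_locally_eq' X.sheaf (fun x : U => V x.1 x.2) U
    (fun x => homOfLE (hV _ _)) (fun x hxU => Opens.mem_iSup.2 ⟨⟨x, hxU⟩, hx x hxU⟩) s t
    (fun x => e _ _)

theorem exists_glue {κ : Type u} (V : κ → X.Opens) (hV : ∀ k, V k ≤ U) (hc : U ≤ iSup V)
    (s : ∀ k, Γ(M, V k))
    (hs : ∀ k l, rs M (inf_le_left : V k ⊓ V l ≤ V k) (s k) =
      rs M (inf_le_right : V k ⊓ V l ≤ V l) (s l)) :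
    ∃ t : Γ(M, U), ∀ k, rs M (hV k) t = s k := by
  obtain ⟨t, ht, -⟩ := TopCat.Sheaf.existsUnique_gluing' ⟨M.presheaf, M.isSheaf⟩ V U
    (fun k => homOfLE (hV k)) hc s hs
  exact ⟨t, ht⟩

theorem exists_fun_glue {κ : Type u} (V : κ → X.Opens) (hV : ∀ k, V k ≤ U) (hc : U ≤ iSup V)
    (s : ∀ k, Γ(X, V k))
    (hs : ∀ k l, ro (inf_le_left : V k ⊓ V l ≤ V k) (s k) =
      ro (inf_le_right : V k ⊓ V l ≤ V l) (s l)) :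
    ∃ t : Γ(X, U), ∀ k, ro (hV k) t = s k := by
  obtain ⟨t, ht, -⟩ := TopCat.Sheaf.existsUnique_gluing' X.sheaf V U
    (fun k => homOfLE (hV k)) hc s hs
  exact ⟨t, ht⟩

/-- Compatibility is required on `W ⊓ (U ⊓ V)`, the form in which transition data given on `U ⊓ V`
restrict. -/
theorem exists_glue_pair (h : W ≤ U ⊔ V) (s : Γ(M, W ⊓ U)) (t : Γ(M, W ⊓ V))
    (e : rs M (inf_le_inf_left W inf_le_left : W ⊓ (U ⊓ V) ≤ W ⊓ U) s =
      rs M (inf_le_inf_left W inf_le_right : W ⊓ (U ⊓ V) ≤ W ⊓ V) t) :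
    ∃ r : Γ(M, W), rs M inf_le_left r = s ∧ rs M inf_le_left r = t := by
  have key : ∀ (A : X.Opens) (h₁ : A ≤ W ⊓ U) (h₂ : A ≤ W ⊓ V), rs M h₁ s = rs M h₂ t := by
    intro A h₁ h₂
    have hA : A ≤ W ⊓ (U ⊓ V) := fun x hx => ⟨(h₁ hx).1, (h₁ hx).2, (h₂ hx).2⟩
    have := congrArg (rs M hA) e
    rwa [rs_rs, rs_rs] at this
  obtain ⟨r, hr⟩ := exists_glue (M := M) (U := W) (κ := ULift.{u} Bool)
    (fun k => if k.down then W ⊓ U else W ⊓ V)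
    (by rintro ⟨_ | _⟩ <;> exact inf_le_left)
    (by
      intro x hx
      rcases h hx with h | h
      · exact Opens.mem_iSup.2 ⟨⟨true⟩, ⟨hx, h⟩⟩
      · exact Opens.mem_iSup.2 ⟨⟨false⟩, ⟨hx, h⟩⟩)
    (fun k => match k with
      | ⟨true⟩ => s
      | ⟨false⟩ => t)
    (by
      rintro ⟨_ | _⟩ ⟨_ | _⟩
      · rfl
      · exact (key _ inf_le_right inf_le_left).symm
      · exact key _ inf_le_left inf_le_right
      · rfl)
  exact ⟨r, hr ⟨true⟩, hr ⟨false⟩⟩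

theorem eq_of_pair (h : W ≤ U ⊔ V) {s t : Γ(M, W)}
    (hU : rs M (inf_le_left : W ⊓ U ≤ W) s = rs M inf_le_left t)
    (hV : rs M (inf_le_left : W ⊓ V ≤ W) s = rs M inf_le_left t) : s = t := by
  refine eq_of_locally fun x hx => ?_
  rcases h hx with h | h
  · exact ⟨_, inf_le_left, ⟨hx, h⟩, hU⟩
  · exact ⟨_, inf_le_left, ⟨hx, h⟩, hV⟩

/-- A morphism of sheaves of modules from its values on sections. -/
def homOfSections (f : ∀ U, Γ(M, U) →+ Γ(N, U))
    (hs : ∀ U (r : Γ(X, U)) (s : Γ(M, U)), f U (r • s) = r • f U s)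
    (hr : ∀ (U V : X.Opens) (h : V ≤ U) (s : Γ(M, U)), f V (rs M h s) = rs N h (f U s)) :
    M ⟶ N :=
  ⟨fun U => ModuleCat.ofHom ⟨(f U.unop).toAddHom, hs U.unop⟩,
    fun i => by ext s; exact hr _ _ i.unop.le s⟩

theorem mono_of_injective (φ : M ⟶ N) (h : ∀ U, Function.Injective (φ.app U)) : Mono φ := by
  refine ⟨fun α β e => ?_⟩
  ext U s
  exact h U congr(($e).app U s)

theorem isIso_of_bijective (φ : M ⟶ N) (h : ∀ U, Function.Bijective (φ.app U)) : IsIso φ := by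
  rw [Scheme.Modules.Hom.isIso_iff_isIso_app]
  intro U
  exact (ConcreteCategory.isIso_iff_bijective _).2 (h U)

theorem injective_of_mono (φ : M ⟶ N) [Mono φ] (U : X.Opens) : Function.Injective (φ.app U) := by
  have : Mono ((Scheme.Modules.toPresheaf X).map φ) := inferInstance
  have h : Mono (((Scheme.Modules.toPresheaf X).map φ).app (op U)) := inferInstance
  exact (AddCommGrpCat.mono_iff_injective _).1 h

/-- Sections of the kernel are the sections mapping to zero. -/
theorem exists_app_eq_of_exact {S : ShortComplex X.Modules} (hS : S.Exact) [Mono S.f]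
    (s : Γ(S.X₂, U)) (h : S.g.app U s = 0) : ∃ t : Γ(S.X₁, U), S.f.app U t = s := by
  -- Taking sections over `U` preserves kernels, so it keeps a sequence with monic first map exact
  -- in the middle.
  let F : X.Modules ⥤ Ab := Scheme.Modules.toPresheaf X ⋙ (evaluation X.Opensᵒᵖ Ab.{u}).obj (op U)
  have : F.PreservesZeroMorphisms := ⟨fun _ _ => rfl⟩
  have : PreservesLimitsOfSize.{0, 0} (Scheme.Modules.toPresheaf X) :=
    preservesLimitsOfSize_shrink _
  have : PreservesLimitsOfShape WalkingParallelPair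
    ((evaluation X.Opensᵒᵖ Ab.{u}).obj (op U)) := evaluation_preservesLimitsOfShape _
  have : PreservesLimitsOfShape WalkingParallelPair F := comp_preservesLimitsOfShape _ _
  have := hS.map_of_mono_of_preservesKernel F inferInstance inferInstance
  exact (ShortComplex.ab_exact_iff _).1 this s h

end Sections

/-! ### Frames -/

section Frames

variable {X : Scheme.{u}} {M N P : X.Modules} {U V W : X.Opens}
variable {ι κ τ : Type*} [Fintype ι]

/-- A frame of `M` on `U`: sections which form a basis of `M` over every open subset of `U`. -/
def IsFrame (M : X.Modules) (U : X.Opens) (b : ι → Γ(M, U)) : Prop :=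
  ∀ (W : X.Opens) (h : W ≤ U),
    Function.Bijective fun a : ι → Γ(X, W) => ∑ i, a i • rs M h (b i)

theorem IsFrame.restrict {b : ι → Γ(M, U)} (hb : IsFrame M U b) (h : V ≤ U) :
    IsFrame M V fun i => rs M h (b i) := by
  intro W hW
  simpa only [rs_rs] using hb W (hW.trans h)

theorem IsFrame.bijective {b : ι → Γ(M, U)} (hb : IsFrame M U b) :
    Function.Bijective fun a : ι → Γ(X, U) => ∑ i, a i • b i := by
  simpa only [rs_self] using hb U le_rfl

theorem IsFrame.exists_coord {b : ι → Γ(M, U)} (hb : IsFrame M U b) (h : W ≤ U) (s : Γ(M, W)) :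
    ∃ a : ι → Γ(X, W), s = ∑ i, a i • rs M h (b i) := by
  obtain ⟨a, ha⟩ := (hb W h).2 s
  exact ⟨a, ha.symm⟩

theorem IsFrame.coord_ext {b : ι → Γ(M, U)} (hb : IsFrame M U b) (h : W ≤ U)
    {a a' : ι → Γ(X, W)} (e : ∑ i, a i • rs M h (b i) = ∑ i, a' i • rs M h (b i)) : a = a' :=
  (hb W h).1 e

theorem rs_sum_smul (h : V ≤ U) (a : ι → Γ(X, U)) (b : ι → Γ(M, U)) :
    rs M h (∑ i, a i • b i) = ∑ i, ro h (a i) • rs M h (b i) := by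
  simp [map_sum, rs_smul]

/-- It suffices to check the frame property on a basis of open sets. -/
theorem isFrame_of_basis {b : ι → Γ(M, U)}
    (H : ∀ (W : X.Opens), W ≤ U → ∀ x ∈ W, ∃ (W' : X.Opens) (h : W' ≤ U), W' ≤ W ∧ x ∈ W' ∧
      Function.Bijective fun a : ι → Γ(X, W') => ∑ i, a i • rs M h (b i)) : IsFrame M U b := by
  -- Injectivity is needed on all smaller opens at once: on overlaps it makes the local coordinates
  -- agree, so that they glue.
  have inj : ∀ (W : X.Opens) (h : W ≤ U),
      Function.Injective fun a : ι → Γ(X, W) => ∑ i, a i • rs M h (b i) := by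
    intro W h a a' e
    funext i
    refine fun_eq_of_locally fun x hx => ?_
    obtain ⟨W', h', hW', hx', hbij⟩ := H W h x hx
    refine ⟨W', hW', hx', ?_⟩
    have e' := congrArg (rs M hW') e
    simp only [rs_sum_smul, rs_rs] at e'
    exact congrFun (hbij.1 e') i
  intro W h
  refine ⟨inj W h, fun s => ?_⟩
  choose W' h' hW' hx' hbij using H W h
  choose a ha using fun (x : W) => (hbij x.1 x.2).2 (rs M (hW' x.1 x.2) s)
  have hcompat : ∀ (x y : W),
      (fun i => ro (inf_le_left : W' x.1 x.2 ⊓ W' y.1 y.2 ≤ _) (a x i)) =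
      fun i => ro (inf_le_right : W' x.1 x.2 ⊓ W' y.1 y.2 ≤ _) (a y i) := by
    intro x y
    apply inj _ (inf_le_left.trans (h' x.1 x.2))
    have e1 := congrArg (rs M (inf_le_left : W' x.1 x.2 ⊓ W' y.1 y.2 ≤ _)) (ha x)
    have e2 := congrArg (rs M (inf_le_right : W' x.1 x.2 ⊓ W' y.1 y.2 ≤ _)) (ha y)
    simp only [rs_sum_smul, rs_rs] at e1 e2
    exact e1.trans e2.symm
  have hglue : ∀ i, ∃ t : Γ(X, W), ∀ x : W, ro (hW' x.1 x.2) t = a x i := fun i =>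
    exists_fun_glue (fun x : W => W' x.1 x.2) (fun x => hW' x.1 x.2)
      (fun x hx => Opens.mem_iSup.2 ⟨⟨x, hx⟩, hx' x hx⟩) (fun x => a x i)
      (fun x y => congrFun (hcompat x y) i)
  choose t ht using hglue
  refine ⟨t, eq_of_locally fun x hx => ⟨_, hW' x hx, hx' x hx, ?_⟩⟩
  simp only [rs_sum_smul, rs_rs, ht _ ⟨x, hx⟩]
  exact ha ⟨x, hx⟩

theorem IsFrame.reindex [Fintype κ] {b : ι → Γ(M, U)} (hb : IsFrame M U b) (e : κ ≃ ι) :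
    IsFrame M U fun k => b (e k) := by
  intro W h
  have := (hb W h).comp (Equiv.arrowCongr e (Equiv.refl Γ(X, W))).bijective
  convert this using 2 with a
  simp only [Function.comp, Equiv.arrowCongr_apply, Equiv.coe_refl, id]
  rw [← Equiv.sum_comp e]
  simp

/-- `c = b A` for families of sections `b`, `c` and a matrix of functions `A`. -/
def IsTransition (b : ι → Γ(M, U)) (c : κ → Γ(M, U)) (A : Matrix ι κ Γ(X, U)) : Prop :=
  ∀ k, c k = ∑ i, A i k • b i

theorem IsFrame.exists_transition {b : ι → Γ(M, U)} (hb : IsFrame M U b) (c : κ → Γ(M, U)) :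
    ∃ A, IsTransition b c A := by
  choose a ha using fun k => hb.bijective.2 (c k)
  exact ⟨fun i k => a k i, fun k => (ha k).symm⟩

theorem IsTransition.mul [Fintype κ] {b : ι → Γ(M, U)} {c : κ → Γ(M, U)} {d : τ → Γ(M, U)}
    {A : Matrix ι κ Γ(X, U)} {B : Matrix κ τ Γ(X, U)} (hA : IsTransition b c A)
    (hB : IsTransition c d B) : IsTransition b d (A * B) := by
  intro t
  rw [hB t]
  simp_rw [hA _, Finset.smul_sum, smul_smul, Matrix.mul_apply, Finset.sum_smul]
  rw [Finset.sum_comm]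
  simp_rw [mul_comm]

theorem IsTransition.unique {b : ι → Γ(M, U)} (hb : IsFrame M U b) {c : κ → Γ(M, U)}
    {A B : Matrix ι κ Γ(X, U)} (hA : IsTransition b c A) (hB : IsTransition b c B) : A = B := by
  ext i k
  exact congrFun (hb.bijective.1 ((hA k).symm.trans (hB k))) i

theorem IsTransition.refl [DecidableEq ι] (b : ι → Γ(M, U)) : IsTransition b b 1 := by
  intro k
  simp [Matrix.one_apply]

theorem IsTransition.restrict {b : ι → Γ(M, U)} {c : κ → Γ(M, U)} {A : Matrix ι κ Γ(X, U)}
    (hA : IsTransition b c A) (h : V ≤ U) :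
    IsTransition (fun i => rs M h (b i)) (fun k => rs M h (c k)) (A.map (ro h)) := by
  intro k
  simp only [hA k, rs_sum_smul, Matrix.map_apply]

theorem IsTransition.map {b : ι → Γ(M, U)} {c : κ → Γ(M, U)} {A : Matrix ι κ Γ(X, U)}
    (hA : IsTransition b c A) (φ : M ⟶ N) :
    IsTransition (fun i => φ.app U (b i)) (fun k => φ.app U (c k)) A := by
  intro k
  simpa only [app_sum] using congrArg (φ.app U) (hA k)

theorem IsFrame.isUnit_det [DecidableEq ι] {b c : ι → Γ(M, U)} {A : Matrix ι ι Γ(X, U)}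
    (hb : IsFrame M U b) (hc : IsFrame M U c) (hA : IsTransition b c A) : IsUnit A.det := by
  obtain ⟨B, hB⟩ := hc.exists_transition b
  have : A * B = 1 := (hA.mul hB).unique hb (IsTransition.refl b)
  exact IsUnit.of_mul_eq_one B.det (by rw [← Matrix.det_mul, this, Matrix.det_one])

/-- An invertible change of a frame is a frame. -/
theorem IsFrame.of_transition [Fintype κ] [DecidableEq ι] [DecidableEq κ]
    {b : ι → Γ(M, U)} {c : κ → Γ(M, U)}
    {A : Matrix ι κ Γ(X, U)} {B : Matrix κ ι Γ(X, U)} (hb : IsFrame M U b)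
    (hA : IsTransition b c A) (hB : IsTransition c b B) (hBA : B * A = 1) : IsFrame M U c := by
  -- Only one product is assumed to be the identity; coordinates with respect to `b` are unique,
  -- which gives the other.
  have hAB : A * B = 1 := (hA.mul hB).unique hb (IsTransition.refl b)
  intro W h
  have hA' := hA.restrict h
  have hB' := hB.restrict h
  have hBA' : B.map (ro h) * A.map (ro h) = 1 := by
    rw [← Matrix.map_mul, hBA, Matrix.map_one _ (map_zero _) (map_one _)]
  have key : ∀ a : κ → Γ(X, W), ∑ k, a k • rs M h (c k) =
      ∑ i, ((A.map (ro h)).mulVec a) i • rs M h (b i) := by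
    intro a
    simp only [hA' _, Finset.smul_sum, smul_smul, Matrix.mulVec, dotProduct, Finset.sum_smul]
    rw [Finset.sum_comm]
    simp_rw [mul_comm]
  constructor
  · intro a a' e
    simp only [key] at e
    have := congrArg (B.map (ro h)).mulVec (hb.coord_ext h e)
    simpa [Matrix.mulVec_mulVec, hBA'] using this
  · intro s
    obtain ⟨a, rfl⟩ := hb.exists_coord h s
    refine ⟨(B.map (ro h)).mulVec a, ?_⟩
    simp only [key, Matrix.mulVec_mulVec]
    rw [← Matrix.map_mul, hAB, Matrix.map_one _ (map_zero _) (map_one _), Matrix.one_mulVec]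

/-- The basis of the module of sections given by a frame. -/
def IsFrame.basis {b : ι → Γ(M, U)} (hb : IsFrame M U b) : Module.Basis ι Γ(X, U) Γ(M, U) :=
  .ofEquivFun (LinearEquiv.ofBijective
    { toFun := fun a : ι → Γ(X, U) => ∑ i, a i • b i
      map_add' := fun a a' => by simp [add_smul, Finset.sum_add_distrib]
      map_smul' := fun r a => by simp [Finset.smul_sum, smul_smul] } hb.bijective).symm

theorem IsFrame.card_eq [Fintype κ] {b : ι → Γ(M, U)} {c : κ → Γ(M, U)} (hb : IsFrame M U b)
    (hc : IsFrame M U c) (x : X) (hx : x ∈ U) : Fintype.card ι = Fintype.card κ := by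
  have : Nonempty U := ⟨⟨x, hx⟩⟩
  have : Nontrivial Γ(X, U) := inferInstance
  exact Fintype.card_congr (hb.basis.indexEquiv hc.basis)

theorem IsFrame.map_iso {b : ι → Γ(M, U)} (hb : IsFrame M U b) (e : M ≅ N) :
    IsFrame N U fun i => e.hom.app U (b i) := by
  intro W h
  have hbij : Function.Bijective (e.hom.app W) :=
    (ConcreteCategory.isIso_iff_bijective _).1 inferInstance
  convert hbij.comp (hb W h) using 2 with a
  simp [app_rs]

/-- Frames of the summands form a frame of a finite direct sum. -/
theorem isFrame_biproduct {J : Type} [Fintype J] [HasFiniteBiproducts X.Modules]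
    (F : J → X.Modules) (b : ∀ j, Γ(F j, U)) (hb : ∀ j, IsFrame (F j) U fun _ : Unit => b j) :
    IsFrame (⨁ F) U fun j => (biproduct.ι F j).app U (b j) := by
  classical
  intro W h
  have hπ : ∀ (a : J → Γ(X, W)) (k : J), (biproduct.π F k).app W
      (∑ j, a j • rs (⨁ F) h ((biproduct.ι F j).app U (b j))) = a k • rs (F k) h (b k) := by
    intro a k
    rw [app_sum, Finset.sum_eq_single k]
    · rw [← app_rs, ← ConcreteCategory.comp_apply, ← Scheme.Modules.Hom.comp_app,
        biproduct.ι_π_self]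
      rfl
    · intro j _ hjk
      rw [← app_rs, ← ConcreteCategory.comp_apply, ← Scheme.Modules.Hom.comp_app,
        biproduct.ι_π_ne _ hjk]
      rw [Scheme.Modules.Hom.zero_app]
      simp
    · simp
  -- A section of the direct sum is determined by its projections: evaluation at `s` is additive in
  -- the morphism, so it can be applied to the decomposition of the identity.
  have hext : ∀ s t : Γ(⨁ F, W), (∀ k, (biproduct.π F k).app W s = (biproduct.π F k).app W t) →
      s = t := by
    have hs : ∀ s : Γ(⨁ F, W),
        s = ∑ k, (biproduct.ι F k).app W ((biproduct.π F k).app W s) := by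
      intro s
      let f : ((⨁ F) ⟶ (⨁ F)) →+ Γ(⨁ F, W) :=
        { toFun := fun φ => φ.app W s, map_zero' := rfl, map_add' := fun _ _ => rfl }
      have := congrArg f (biproduct.total (f := F))
      rw [map_sum] at this
      exact this.symm
    intro s t hst
    rw [hs s, hs t]
    simp_rw [hst]
  constructor
  · intro a a' e
    funext k
    have := congrArg ((biproduct.π F k).app W) e
    simp only [hπ] at this
    exact congrFun ((hb k).coord_ext h (a := fun _ => a k) (a' := fun _ => a' k)
      (by simpa using this)) ()
  · intro s
    choose a ha using fun k => (hb k).exists_coord h ((biproduct.π F k).app W s)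
    refine ⟨fun k => a k (), hext _ _ fun k => ?_⟩
    rw [hπ, ha k]
    simp

end Frames

/-! ### Morphisms defined by frames; local freeness in terms of frames -/

section FramesAndHoms

variable {X Y : Scheme.{u}} {M N : X.Modules} {U V : X.Opens}
variable {ι κ : Type*} [Fintype ι] [Fintype κ]

/-- Morphisms out of a module with frames on the two members of an open cover are given by
compatible images of the frames. -/
theorem exists_hom_of_frames (hc : (⊤ : X.Opens) ≤ U ⊔ V)
    {e : ι → Γ(N, U)} {e' : κ → Γ(N, V)} (he : IsFrame N U e) (he' : IsFrame N V e')
    (v : ι → Γ(M, U)) (v' : κ → Γ(M, V)) (g : Matrix κ ι Γ(X, U ⊓ V))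
    (hg : IsTransition (fun k => rs N inf_le_right (e' k)) (fun i => rs N inf_le_left (e i)) g)
    (hv : IsTransition (fun k => rs M inf_le_right (v' k)) (fun i => rs M inf_le_left (v i)) g) :
    ∃ φ : N ⟶ M, (∀ i, φ.app U (e i) = v i) ∧ ∀ k, φ.app V (e' k) = v' k := by
  -- The graph of the desired morphism: `s` and `r` have the same coordinates over both members of
  -- the cover. It is functional, and linearity and naturality then follow from uniqueness.
  let R : ∀ W : X.Opens, Γ(N, W) → Γ(M, W) → Prop := fun W s r =>
    ∃ (a : ι → Γ(X, W ⊓ U)) (a' : κ → Γ(X, W ⊓ V)),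
      rs N inf_le_left s = ∑ i, a i • rs N inf_le_right (e i) ∧
      rs M inf_le_left r = ∑ i, a i • rs M inf_le_right (v i) ∧
      rs N inf_le_left s = ∑ k, a' k • rs N inf_le_right (e' k) ∧
      rs M inf_le_left r = ∑ k, a' k • rs M inf_le_right (v' k)
  have huniq : ∀ W s r r', R W s r → R W s r' → r = r' := by
    rintro W s r r' ⟨a, a', h1, h2, h3, h4⟩ ⟨b, b', k1, k2, k3, k4⟩
    obtain rfl := he.coord_ext inf_le_right (h1.symm.trans k1)
    obtain rfl := he'.coord_ext inf_le_right (h3.symm.trans k3)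
    exact eq_of_pair (le_top.trans hc) (h2.trans k2.symm) (h4.trans k4.symm)
  have hex : ∀ W s, ∃ r, R W s r := by
    intro W s
    obtain ⟨a, ha⟩ := he.exists_coord (inf_le_right : W ⊓ U ≤ U) (rs N inf_le_left s)
    obtain ⟨a', ha'⟩ := he'.exists_coord (inf_le_right : W ⊓ V ≤ V) (rs N inf_le_left s)
    have i₁ : W ⊓ (U ⊓ V) ≤ W ⊓ U := inf_le_inf_left W inf_le_left
    have i₂ : W ⊓ (U ⊓ V) ≤ W ⊓ V := inf_le_inf_left W inf_le_right
    have i₃ : W ⊓ (U ⊓ V) ≤ U ⊓ V := inf_le_right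
    -- On the overlap the two coordinate vectors of `s` are related by `g`; as `v` and `v'` satisfy
    -- the same relation, the two candidate images agree there.
    have hcoord : ∀ k, ∑ i, ro i₁ (a i) * ro i₃ (g k i) = ro i₂ (a' k) := by
      have e1 := congrArg (rs N i₁) ha
      have e2 := congrArg (rs N i₂) ha'
      simp only [rs_sum_smul, rs_rs] at e1 e2
      have hg' := fun i => congrArg (rs N i₃) (hg i)
      simp only [rs_sum_smul, rs_rs] at hg'
      simp_rw [hg', Finset.smul_sum, smul_smul] at e1
      rw [Finset.sum_comm] at e1
      simp_rw [← Finset.sum_smul] at e1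
      exact congrFun (he'.coord_ext _ (e1.symm.trans e2))
    obtain ⟨r, hr, hr'⟩ := exists_glue_pair (M := M) (le_top.trans hc : W ≤ U ⊔ V)
      (∑ i, a i • rs M inf_le_right (v i)) (∑ k, a' k • rs M inf_le_right (v' k)) (by
        simp only [rs_sum_smul, rs_rs]
        have hv' := fun i => congrArg (rs M i₃) (hv i)
        simp only [rs_sum_smul, rs_rs] at hv'
        simp_rw [hv', Finset.smul_sum, smul_smul]
        rw [Finset.sum_comm]
        simp_rw [← Finset.sum_smul, hcoord])
    exact ⟨r, a, a', ha, hr, ha', hr'⟩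
  choose f hf using hex
  have hadd : ∀ W s t, f W (s + t) = f W s + f W t := by
    intro W s t
    refine huniq W (s + t) _ _ (hf W _) ?_
    obtain ⟨a, a', h1, h2, h3, h4⟩ := hf W s
    obtain ⟨b, b', k1, k2, k3, k4⟩ := hf W t
    exact ⟨a + b, a' + b', by simp [h1, k1, add_smul, Finset.sum_add_distrib],
      by simp [h2, k2, add_smul, Finset.sum_add_distrib],
      by simp [h3, k3, add_smul, Finset.sum_add_distrib],
      by simp [h4, k4, add_smul, Finset.sum_add_distrib]⟩
  have hsmul : ∀ W (r : Γ(X, W)) (s : Γ(N, W)), f W (r • s) = r • f W s := by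
    intro W r s
    refine huniq W (r • s) _ _ (hf W _) ?_
    obtain ⟨a, a', h1, h2, h3, h4⟩ := hf W s
    exact ⟨fun i => ro inf_le_left r * a i, fun k => ro inf_le_left r * a' k,
      by simp [rs_smul, h1, Finset.smul_sum, smul_smul],
      by simp [rs_smul, h2, Finset.smul_sum, smul_smul],
      by simp [rs_smul, h3, Finset.smul_sum, smul_smul],
      by simp [rs_smul, h4, Finset.smul_sum, smul_smul]⟩
  have hnat : ∀ (W W' : X.Opens) (h : W' ≤ W) (s : Γ(N, W)), f W' (rs N h s) = rs M h (f W s) := by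
    intro W W' h s
    refine huniq W' _ _ _ (hf W' _) ?_
    obtain ⟨a, a', h1, h2, h3, h4⟩ := hf W s
    have jU : W' ⊓ U ≤ W ⊓ U := inf_le_inf_right _ h
    have jV : W' ⊓ V ≤ W ⊓ V := inf_le_inf_right _ h
    have k1 := congrArg (rs _ jU) h1
    have k2 := congrArg (rs _ jU) h2
    have k3 := congrArg (rs _ jV) h3
    have k4 := congrArg (rs _ jV) h4
    simp only [rs_sum_smul, rs_rs] at k1 k2 k3 k4
    exact ⟨fun i => ro jU (a i), fun i => ro jV (a' i), by simpa only [rs_rs] using k1,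
      by simpa only [rs_rs] using k2, by simpa only [rs_rs] using k3,
      by simpa only [rs_rs] using k4⟩
  refine ⟨homOfSections (fun W => AddMonoidHom.mk' (f W) (hadd W)) hsmul hnat,
    fun i => ?_, fun k => ?_⟩
  · classical
    change f U (e i) = v i
    obtain ⟨a, -, h1, h2, -, -⟩ := hf U (e i)
    -- A frame member has a standard unit vector as its coordinates.
    have ha : Pi.single i 1 = a := he.coord_ext inf_le_right (by simp [← h1, Pi.single_apply])
    have := congrArg (rs M (le_inf le_rfl le_rfl : U ≤ U ⊓ U)) h2
    simpa [← ha, Pi.single_apply, rs_rs] using this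
  · classical
    change f V (e' k) = v' k
    obtain ⟨-, a, -, -, h1, h2⟩ := hf V (e' k)
    have ha : Pi.single k 1 = a := he'.coord_ext inf_le_right (by simp [← h1, Pi.single_apply])
    have := congrArg (rs M (le_inf le_rfl le_rfl : V ≤ V ⊓ V)) h2
    simpa [← ha, Pi.single_apply, rs_rs] using this

theorem IsFrame.bijective_app {φ : N ⟶ M} {e : ι → Γ(N, U)} (he : IsFrame N U e)
    (h : IsFrame M U fun i => φ.app U (e i)) (hV : V ≤ U) : Function.Bijective (φ.app V) := by
  have := h V hV
  simp only [← app_rs, ← app_sum] at this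
  exact (Function.Bijective.of_comp_iff (φ.app V) (he V hV)).1 this

theorem nonempty_iso_of_frames {e : ι → Γ(N, ⊤)} {v : ι → Γ(M, ⊤)} (he : IsFrame N ⊤ e)
    (hv : IsFrame M ⊤ v) : Nonempty (N ≅ M) := by
  classical
  obtain ⟨φ, h, -⟩ := exists_hom_of_frames (M := M) le_sup_left he he v v 1
    (IsTransition.refl _) (IsTransition.refl _)
  obtain rfl : (fun i => φ.app ⊤ (e i)) = v := funext h
  have := isIso_of_bijective φ fun V => he.bijective_app hv le_top
  exact ⟨asIso φ⟩

/-- The structure sheaf as a module over itself. -/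
def unitModule (X : Scheme.{u}) : X.Modules := SheafOfModules.unit X.ringCatSheaf

theorem isFrame_unit (X : Scheme.{u}) :
    IsFrame (unitModule X) ⊤
      fun _ : Unit => (1 : Γ(X, ⊤)) := by
  intro W h
  have h1 : rs (unitModule X) h (1 : Γ(X, ⊤)) =
    (1 : Γ(X, W)) := map_one (ro h)
  simp only [Finset.univ_unique, Finset.sum_singleton]
  have h2 : ∀ a : Unit → Γ(X, W), a () •
    (rs (unitModule X) h (1 : Γ(X, ⊤))) = a () := by
    intro a
    rw [h1]
    exact mul_one (a ())
  constructor
  · intro a a' e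
    exact funext fun _ => (h2 a).symm.trans (e.trans (h2 a'))
  · intro s
    exact ⟨fun _ => s, h2 fun _ => s⟩

/-- A free sheaf is a coproduct of copies of the unit; for a finite index set this is a biproduct,
and the frames of the summands combine. -/
theorem exists_isFrame_free (X : Scheme.{u}) (r : ℕ) :
    ∃ e : Fin r → Γ((SheafOfModules.free (R := X.ringCatSheaf) (ULift.{u} (Fin r)) :
      X.Modules), ⊤), IsFrame _ ⊤ e := by
  let F : Fin r → X.Modules := fun _ => unitModule X
  let i : (⨁ F) ≅ (SheafOfModules.free (R := X.ringCatSheaf) (ULift.{u} (Fin r)) : X.Modules) :=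
    biproduct.isoCoproduct F ≪≫
      Sigma.whiskerEquiv (f := F) (g := fun _ : ULift.{u} (Fin r) => unitModule X)
        Equiv.ulift.symm fun _ => Iso.refl _
  exact ⟨_, (isFrame_biproduct F _ fun _ => isFrame_unit X).map_iso i⟩

variable (j : Y ⟶ X) [IsOpenImmersion j]

/-- A frame of a restriction to an open subscheme is a frame. -/
theorem isFrame_restrict_iff {V : Y.Opens} (b : ι → Γ(M, j ''ᵁ V)) :
    IsFrame (M.restrict j) V b ↔ IsFrame M (j ''ᵁ V) b := by
  have key : ∀ (W : Y.Opens) (h : W ≤ V),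
      (Function.Bijective fun a : ι → Γ(Y, W) => ∑ i, a i • rs (M.restrict j) h (b i)) ↔
      Function.Bijective fun a : ι → Γ(X, j ''ᵁ W) =>
        ∑ i, a i • rs M (j.image_mono h) (b i) := by
    intro W h
    have hb : Function.Bijective (j.appIso W).inv :=
      (ConcreteCategory.isIso_iff_bijective _).1 inferInstance
    rw [← Function.Bijective.of_comp_iff _ (Function.Bijective.piMap fun _ : ι => hb)]
    rfl
  constructor
  · intro H W h
    -- Every open set inside the image of an open immersion is itself an image, so the two
    -- conditions range over the same opens.
    obtain ⟨W, rfl⟩ : ∃ W' : Y.Opens, j ''ᵁ W' = W := by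
      refine ⟨j ⁻¹ᵁ W, ?_⟩
      rw [Scheme.Hom.image_preimage_eq_opensRange_inf]
      exact inf_eq_right.2 (h.trans (j.image_le_opensRange V))
    have h' : W ≤ V := (j.image_le_image_iff W V).1 h
    exact (key W h').1 (H W h')
  · intro H W h
    exact (key W h).2 (H _ (j.image_mono h))

/-- From here on local freeness is handled through sections of `M` itself, without open subschemes
and isomorphisms with free sheaves. -/
theorem hasRankAt_iff {x : X} {r : ℕ} :
    HasRankAt M x r ↔ ∃ U : X.Opens, x ∈ U ∧ ∃ b : Fin r → Γ(M, U), IsFrame M U b := by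
  constructor
  · rintro ⟨U, hx, ⟨e⟩⟩
    obtain ⟨b, hb⟩ := exists_isFrame_free (U : Scheme.{u}) r
    have := (isFrame_restrict_iff U.ι _).1 (hb.map_iso e.symm)
    exact ⟨U, hx, _, this.restrict (by simp)⟩
  · rintro ⟨U, hx, b, hb⟩
    refine ⟨U, hx, ?_⟩
    obtain ⟨e, he⟩ := exists_isFrame_free (U : Scheme.{u}) r
    have hb' := (isFrame_restrict_iff U.ι (V := ⊤) _).2
      (hb.restrict (show U.ι ''ᵁ ⊤ ≤ U by simp))
    exact nonempty_iso_of_frames hb' he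

end FramesAndHoms

/-! ### Locally free sheaves are quasicoherent -/

section Quasicoherent

/-- The presentation of a free sheaf of modules without relations. -/
def freePresentation {X : Scheme.{u}} (I : Type u) :
    (SheafOfModules.free (R := X.ringCatSheaf) I).Presentation :=
  SheafOfModules.presentationOfIsCokernelFree
    (0 : SheafOfModules.free (R := X.ringCatSheaf) PEmpty.{u + 1} ⟶ _) (𝟙 _) (by simp)
    (CokernelCofork.IsColimit.ofId _ rfl)

/-- The relation-free presentation of a free sheaf on the open subscheme is carried through the
equivalence with modules over the slice site, where quasicoherence is defined. -/
theorem isQuasicoherent_of_locallyFree {X : Scheme.{u}} {M : X.Modules}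
    (h : IsLocallyFreeFiniteRank M) : M.IsQuasicoherent := by
  choose r U hx e using h
  have hc : (Opens.grothendieckTopology X).CoversTop U := by
    rw [Opens.coversTop_iff]
    exact eq_top_iff.2 fun x _ => Opens.mem_iSup.2 ⟨x, hx x⟩
  have p : ∀ x, (SheafOfModules.over M (U x)).Presentation := by
    intro x
    let F : SheafOfModules.{u} (U x : Scheme.{u}).ringCatSheaf ⥤
      SheafOfModules.{u} (X.ringCatSheaf.over (U x)) := (Scheme.Modules.overEquiv (U x)).inverse
    have η : SheafOfModules.unit _ ≅ F.obj (SheafOfModules.unit _) :=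
      (Scheme.Modules.overEquiv (U x)).unitIso.app (SheafOfModules.unit _)
    have i : SheafOfModules.over M (U x) ≅ F.obj (SheafOfModules.free (ULift (Fin (r x)))) :=
      (Scheme.Modules.overEquiv (U x)).unitIso.app _ ≪≫
        F.mapIso ((Scheme.Modules.overFunctorEquiv (U x)).app M ≪≫ (e x).some)
    have : PreservesColimitsOfSize.{u, u} F :=
      (Scheme.Modules.overEquiv (U x)).symm.toAdjunction.leftAdjoint_preservesColimits
    exact ((freePresentation _).map F η).ofIsIso i.inv
  exact SheafOfModules.QuasicoherentData.isQuasicoherent (M := M)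
    { I := X, X := U, coversTop := hc, presentation := p }

end Quasicoherent

/-! ### Fully faithful left adjoints, epimorphisms and cokernels -/

section Adjunction

variable {C D : Type*} [Category C] [Category D] {F : C ⥤ D} {G : D ⥤ C}

/-- On the essential image the counit is invertible, so `F (G φ)` is an epimorphism along with `φ`,
and a faithful functor reflects epimorphisms. For sheaves associated with modules this is the right
exactness of global sections. -/
theorem epi_map_of_essImage (adj : F ⊣ G) [F.Full] [F.Faithful] {M N : D} (hM : F.essImage M)
    (hN : F.essImage N) (φ : M ⟶ N) [Epi φ] : Epi (G.map φ) := by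
  have := adj.isIso_counit_app_iff_mem_essImage.2 hM
  have := adj.isIso_counit_app_iff_mem_essImage.2 hN
  have hn := adj.counit.naturality φ
  have h1 : Epi ((G ⋙ F).map φ ≫ adj.counit.app N) := by
    rw [hn]
    exact epi_comp _ _
  exact F.epi_of_epi_map ((epi_comp_iff_of_isIso _ _).1 h1)

/-- The left adjoint `F` preserves cokernels, and the counit identifies `φ` with `F (G φ)`. -/
theorem essImage_cokernel (adj : F ⊣ G) [F.Full] [F.Faithful] [HasZeroMorphisms C]
    [HasZeroMorphisms D] [HasCokernels C] [HasCokernels D] {M N : D} (hM : F.essImage M)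
    (hN : F.essImage N) (φ : M ⟶ N) : F.essImage (cokernel φ) := by
  have := adj.isIso_counit_app_iff_mem_essImage.2 hM
  have := adj.isIso_counit_app_iff_mem_essImage.2 hN
  have := adj.leftAdjoint_preservesColimits
  have : F.PreservesZeroMorphisms := inferInstance
  exact ⟨cokernel (G.map φ), ⟨PreservesCokernel.iso F (G.map φ) ≪≫
    cokernel.mapIso _ _ (asIso (adj.counit.app M)) (asIso (adj.counit.app N))
      (adj.counit.naturality φ)⟩⟩

end Adjunction

/-! ### Sheaves of modules on affine schemes -/

section Affine

variable (R : CommRingCat.{u})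

/-- The sheaf associated with a module. -/
def tildeFunctor : ModuleCat R ⥤ (Spec R).Modules := tilde.functor R

/-- The module of global sections. -/
def gammaFunctor : (Spec R).Modules ⥤ ModuleCat R := moduleSpecΓFunctor (R := R)

/-- Sheaves associated with modules are left adjoint to global sections. -/
def tildeAdjunction : tildeFunctor R ⊣ gammaFunctor R := tilde.adjunction (R := R)

instance : (tildeFunctor R).Full := inferInstanceAs (tilde.functor R).Full
instance : (tildeFunctor R).Faithful := inferInstanceAs (tilde.functor R).Faithful

variable {R} {M N : (Spec R).Modules}

/-- A sheaf of modules on an affine scheme is associated with a module. -/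
abbrev IsTilde (M : (Spec R).Modules) : Prop := (tildeFunctor R).essImage M

theorem app_top_surjective_of_epi (φ : M ⟶ N) [Epi φ] (hM : IsTilde M) (hN : IsTilde N) :
    Function.Surjective (φ.app ⊤) := by
  have := epi_map_of_essImage (tildeAdjunction R) hM hN φ
  exact (ModuleCat.epi_iff_surjective ((gammaFunctor R).map φ)).1 this

theorem isTilde_cokernel (φ : M ⟶ N) (hM : IsTilde M) (hN : IsTilde N) :
    IsTilde (cokernel φ) :=
  essImage_cokernel (tildeAdjunction R) hM hN φ

theorem IsTilde.of_isQuasicoherent (h : M.IsQuasicoherent) : IsTilde M :=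
  isIso_fromTildeΓ_iff.1 ((isQuasicoherent_iff_isIso_fromTildeΓ (R := R) M).1 h)

theorem IsTilde.restrict {X : Scheme.{u}} (E : X.Modules) (hE : IsLocallyFreeFiniteRank E)
    (j : Spec R ⟶ X) [IsOpenImmersion j] : IsTilde (E.restrict j) := by
  have := isQuasicoherent_of_locallyFree hE
  exact IsTilde.of_isQuasicoherent (Scheme.Modules.isQuasicoherent_restrictFunctor j E)

/-- This makes a quotient accessible before it is known to be locally free. -/
theorem IsTilde.restrict_cokernel {X : Scheme.{u}} {E F : X.Modules}
    (hE : IsLocallyFreeFiniteRank E) (hF : IsLocallyFreeFiniteRank F) (φ : E ⟶ F)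
    (j : Spec R ⟶ X) [IsOpenImmersion j] : IsTilde ((cokernel φ).restrict j) := by
  have := isTilde_cokernel ((Scheme.Modules.restrictFunctor j).map φ) (IsTilde.restrict E hE j)
    (IsTilde.restrict F hF j)
  exact (tildeFunctor R).essImage.prop_of_iso
    (PreservesCokernel.iso (Scheme.Modules.restrictFunctor j) φ).symm this

theorem IsTilde.isLocalizing (hM : IsTilde M) : IsLocalizing (modulesSpecToSheaf.obj M) :=
  (isIso_fromTildeΓ_iff_isLocalizing (R := R) M).1 (isIso_fromTildeΓ_iff.2 hM)

/-- Restriction of global sections as a linear map. -/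
def restrictLinear (M : (Spec R).Modules) (D : (Spec R).Opens) : Γ(M, ⊤) →ₗ[R] Γ(M, D) where
  toFun := rs M le_top
  map_add' := map_add _
  map_smul' r x := M.map_smul_Spec (homOfLE le_top).op r x

theorem IsTilde.isLocalizedModule (hM : IsTilde M) {D : (Spec R).Opens} {f : R}
    (h : D = PrimeSpectrum.basicOpen f) :
    IsLocalizedModule (.powers f) (restrictLinear M D) := by
  subst h
  exact hM.isLocalizing f

theorem isLocalization_basicOpen_spec {D : (Spec R).Opens} {f : R}
    (h : D = PrimeSpectrum.basicOpen f) : IsLocalization.Away f Γ(Spec R, D) := by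
  subst h
  exact IsAffineOpen.instAwayCarrierObjOppositeOpensCarrierCarrierCommRingCatSpecPresheafOpOpensBasicOpen

/-- A basis of the module of global sections is a frame. -/
theorem isFrame_top_of_basis {ι : Type*} [Fintype ι] (hM : IsTilde M)
    (b : Module.Basis ι R Γ(M, ⊤)) : IsFrame M ⊤ b := by
  refine isFrame_of_basis fun W _ x hx => ?_
  obtain ⟨_, ⟨_, ⟨f, rfl⟩, rfl⟩, hxf, hf⟩ :=
    PrimeSpectrum.isBasis_basic_opens.exists_subset_of_mem_open hx W.2
  obtain ⟨D, hD⟩ : ∃ D : (Spec R).Opens, D = PrimeSpectrum.basicOpen f := ⟨_, rfl⟩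
  have := hM.isLocalizedModule hD
  have := isLocalization_basicOpen_spec hD
  refine ⟨D, le_top, hD ▸ hf, hD ▸ hxf, ?_⟩
  -- Sections over `D(f)` are the localization at `f` of the global sections, and a basis localizes
  -- to a basis.
  let β := b.ofIsLocalizedModule Γ(Spec R, D) (.powers f) (restrictLinear M D)
  convert β.equivFun.symm.bijective using 2 with a
  rw [Module.Basis.equivFun_symm_apply]
  refine Finset.sum_congr rfl fun i _ => ?_
  rw [Module.Basis.ofIsLocalizedModule_apply]
  rfl

/-- Over a principal ideal domain a locally free sheaf of finite rank has a global frame. -/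
theorem exists_isFrame_top [IsDomain R] [IsPrincipalIdealRing R] (hM : IsTilde M)
    (h : ∀ x : Spec R, ∃ U : (Spec R).Opens, x ∈ U ∧ ∃ (r : ℕ) (b : Fin r → Γ(M, U)),
      IsFrame M U b) : ∃ (n : ℕ) (b : Fin n → Γ(M, ⊤)), IsFrame M ⊤ b := by
  have h' : ∀ x : Spec R, ∃ (f : R) (D : (Spec R).Opens), D = PrimeSpectrum.basicOpen f ∧ x ∈ D ∧
      ∃ (r : ℕ) (b : Fin r → Γ(M, D)), IsFrame M D b := by
    intro x
    obtain ⟨U, hx, r, b, hb⟩ := h x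
    obtain ⟨_, ⟨_, ⟨f, rfl⟩, rfl⟩, hxf, hf⟩ :=
      PrimeSpectrum.isBasis_basic_opens.exists_subset_of_mem_open hx U.2
    exact ⟨f, PrimeSpectrum.basicOpen f, rfl, hxf, r, _, hb.restrict hf⟩
  choose f D hD hx r b hb using h'
  -- The sets `D(f x)` cover, so no maximal ideal contains all `f x`.
  have hspan : Ideal.span (Set.range f) = ⊤ := by
    by_contra hne
    obtain ⟨m, hm, hle⟩ := Ideal.exists_le_maximal _ hne
    have : (⟨m, hm.isPrime⟩ : PrimeSpectrum R) ∈ PrimeSpectrum.basicOpen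
        (f ⟨m, hm.isPrime⟩) := by
      have h := hx ⟨m, hm.isPrime⟩
      exact (SetLike.ext_iff.1 (hD ⟨m, hm.isPrime⟩) _).1 h
    exact this (hle (Ideal.subset_span ⟨_, rfl⟩))
  have hfin : Module.Finite R Γ(M, ⊤) := by
    choose x hxf using fun t : Set.range f => t.2
    have h₁ := fun t : Set.range f => isLocalization_basicOpen_spec (f := t.1)
      (by rw [← hxf t]; exact hD (x t))
    have h₂ := fun t : Set.range f => hM.isLocalizedModule (f := t.1)
      (by rw [← hxf t]; exact hD (x t))
    exact Module.Finite.of_localizationSpan' (Set.range f) hspan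
      (Mₚ := fun t => Γ(M, D (x t))) (Rₚ := fun t => Γ(Spec R, D (x t)))
      (h₁ := h₁) (h₂ := h₂)
      (fun t => restrictLinear M (D (x t)))
      (fun t => Module.Finite.of_basis (hb (x t)).basis)
  -- Torsion is tested on each `D(f x)`. There `M` has a frame, and `f x ≠ 0` makes the ring a
  -- domain into which `R` embeds.
  have htf : Module.IsTorsionFree R Γ(M, ⊤) := by
    refine Module.IsTorsionFree.of_smul_eq_zero fun a m ham => ?_
    rw [or_iff_not_imp_left]
    intro ha
    refine eq_of_locally fun x _ => ⟨D x, le_top, hx x, ?_⟩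
    have hf : f x ≠ 0 := by
      intro h0
      have h := (SetLike.ext_iff.1 (hD x) _).1 (hx x)
      rw [h0, PrimeSpectrum.basicOpen_zero] at h
      exact h
    have := isLocalization_basicOpen_spec (hD x)
    have hle := powers_le_nonZeroDivisors_of_noZeroDivisors hf
    have := IsLocalization.isDomain_of_le_nonZeroDivisors (S := Γ(Spec R, D x)) (M := .powers (f x))
      hle
    obtain ⟨c, hc⟩ := (hb x).exists_coord le_rfl (rs M le_top m)
    have h1 : a • rs M (le_top : D x ≤ ⊤) m = 0 := by
      have := (restrictLinear M (D x)).map_smul a m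
      rw [ham, map_zero] at this
      exact this.symm
    rw [hc, ← algebraMap_smul Γ(Spec R, D x) a, Finset.smul_sum] at h1
    simp_rw [smul_smul] at h1
    have h2 := (hb x).coord_ext le_rfl (a' := 0) (h1.trans (by simp))
    have h3 : algebraMap R Γ(Spec R, D x) a ≠ 0 := fun h => ha
      (IsLocalization.injective Γ(Spec R, D x) hle (h.trans (map_zero _).symm))
    have h4 : c = 0 := funext fun i => (mul_eq_zero.1 (congrFun h2 i)).resolve_left h3
    simp [hc, h4]
  -- A finite torsion-free module over a principal ideal domain is free.
  let β := Module.finBasis R Γ(M, ⊤)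
  exact ⟨_, _, isFrame_top_of_basis hM β⟩

end Affine

/-! ### Frames over affine open subsets of a scheme -/

section AffineOpen

/-- A family of sections over an affine scheme which is a basis of the global sections is a
frame. -/
theorem isFrame_top_of_bijective {R : CommRingCat.{u}} {M : (Spec R).Modules} {ι : Type*}
    [Fintype ι] (hM : IsTilde M) (b : ι → Γ(M, ⊤))
    (h : Function.Bijective fun a : ι → Γ(Spec R, ⊤) => ∑ i, a i • b i) : IsFrame M ⊤ b := by
  let β : Module.Basis ι Γ(Spec R, ⊤) Γ(M, ⊤) :=
    .ofEquivFun (LinearEquiv.ofBijective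
      { toFun := fun a : ι → Γ(Spec R, ⊤) => ∑ i, a i • b i
        map_add' := fun a a' => by simp [add_smul, Finset.sum_add_distrib]
        map_smul' := fun r a => by simp [Finset.smul_sum, smul_smul] } h).symm
  have hβ : ∀ i, β i = b i := by
    classical
    intro i
    simp [β, Module.Basis.ofEquivFun, Pi.single_apply]
  have hbij : Function.Bijective (algebraMap R Γ(Spec R, ⊤)) :=
    (ConcreteCategory.isIso_iff_bijective (Scheme.ΓSpecIso R).inv).1 inferInstance
  let f : R ≃+* Γ(Spec R, ⊤) := RingEquiv.ofBijective _ hbij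
  have hf : ∀ (c : Γ(Spec R, ⊤)) (x : Γ(M, ⊤)), f.symm c • x = c • x := by
    intro c x
    rw [← algebraMap_smul Γ(Spec R, ⊤) (f.symm c) x]
    congr 1
    exact f.apply_symm_apply c
  have hb : b = β.mapCoeffs f.symm hf :=
    funext fun i => (hβ i).symm.trans (Module.Basis.mapCoeffs_apply β f.symm hf i).symm
  rw [hb]
  exact isFrame_top_of_basis hM (β.mapCoeffs f.symm hf)

variable {X : Scheme.{u}} {U : X.Opens} {M N : X.Modules}

theorem image_top_fromSpec (hU : IsAffineOpen U) : hU.fromSpec ''ᵁ ⊤ = U := by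
  rw [Scheme.Hom.image_top_eq_opensRange, hU.opensRange_fromSpec]

/-- Bijectivity over `U` alone suffices, because the sections over smaller basic opens are
localizations of those over `U`. -/
theorem isFrame_of_bijective (hU : IsAffineOpen U) (hM : IsTilde (M.restrict hU.fromSpec))
    {ι : Type*} [Fintype ι] (b : ι → Γ(M, U))
    (h : Function.Bijective fun a : ι → Γ(X, U) => ∑ i, a i • b i) : IsFrame M U b := by
  -- The image of the whole spectrum equals `U` only propositionally, so the claim is proved for a
  -- variable open set and the equality is substituted.
  have key : ∀ (V : X.Opens) (_ : hU.fromSpec ''ᵁ ⊤ = V) (b : ι → Γ(M, V))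
      (_ : Function.Bijective fun a : ι → Γ(X, V) => ∑ i, a i • b i), IsFrame M V b := by
    rintro _ rfl b h
    refine (isFrame_restrict_iff hU.fromSpec b).1 (isFrame_top_of_bijective hM b ?_)
    have hb : Function.Bijective (hU.fromSpec.appIso ⊤).inv :=
      (ConcreteCategory.isIso_iff_bijective _).1 inferInstance
    exact h.comp (Function.Bijective.piMap fun _ : ι => hb)
  exact key U (image_top_fromSpec hU) b h

/-- A morphism of locally free sheaves which is an epimorphism is surjective on the sections over
an affine open set. -/
theorem app_surjective_of_epi (hU : IsAffineOpen U) (φ : M ⟶ N) [Epi φ]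
    (hM : IsTilde (M.restrict hU.fromSpec)) (hN : IsTilde (N.restrict hU.fromSpec)) :
    Function.Surjective (φ.app U) := by
  have key : ∀ (V : X.Opens) (_ : hU.fromSpec ''ᵁ ⊤ = V), Function.Surjective (φ.app V) := by
    rintro _ rfl
    have : Epi ((Scheme.Modules.restrictFunctor hU.fromSpec).map φ) := inferInstance
    exact app_top_surjective_of_epi ((Scheme.Modules.restrictFunctor hU.fromSpec).map φ) hM hN
  exact key U (image_top_fromSpec hU)

/-- A locally free sheaf has a frame over each affine open set with principal ideal domain of
functions. -/
theorem exists_isFrame (hU : IsAffineOpen U) [IsDomain Γ(X, U)] [IsPrincipalIdealRing Γ(X, U)]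
    (hM : IsLocallyFreeFiniteRank M) : ∃ (n : ℕ) (b : Fin n → Γ(M, U)), IsFrame M U b := by
  obtain ⟨n, b, hb⟩ := exists_isFrame_top (IsTilde.restrict M hM hU.fromSpec) (by
    intro x
    obtain ⟨r, hr⟩ := hM (hU.fromSpec x)
    obtain ⟨V, hx, b, hb⟩ := hasRankAt_iff.1 hr
    have h : hU.fromSpec ''ᵁ (hU.fromSpec ⁻¹ᵁ V) ≤ V := by
      rw [Scheme.Hom.image_preimage_eq_opensRange_inf]
      exact inf_le_right
    exact ⟨hU.fromSpec ⁻¹ᵁ V, hx, r, _,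
      (isFrame_restrict_iff hU.fromSpec _).2 (hb.restrict h)⟩)
  exact ⟨n, _, ((isFrame_restrict_iff hU.fromSpec _).1 hb).restrict (image_top_fromSpec hU).ge⟩

theorem IsFrame.of_basis {ι κ : Type*} [Fintype ι] [Fintype κ] {b : ι → Γ(M, U)}
    (hb : IsFrame M U b) (c : Module.Basis κ Γ(X, U) Γ(M, U)) : IsFrame M U c := by
  classical
  have hβ : ∀ i, hb.basis i = b i := by
    intro i
    simp [IsFrame.basis, Module.Basis.ofEquivFun, Pi.single_apply]
  refine hb.of_transition (A := hb.basis.toMatrix c) (B := c.toMatrix hb.basis) (fun k => ?_)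
    (fun i => ?_) (c.toMatrix_mul_toMatrix_flip hb.basis)
  · conv_lhs => rw [← hb.basis.sum_toMatrix_smul_self c k]
    simp [hβ]
  · conv_lhs => rw [← hβ, ← c.sum_toMatrix_smul_self hb.basis i]

end AffineOpen

/-! ### Frames in short exact sequences -/

section Exact

variable {X : Scheme.{u}} {U : X.Opens}

/-- In a short exact sequence, the image of a frame of the sub and a lift of a frame of the quotient
form a frame. -/
theorem isFrame_of_shortExact {S : ShortComplex X.Modules} (hS : S.ShortExact) {ι κ : Type*}
    [Fintype ι] [Fintype κ] {b : ι → Γ(S.X₁, U)} (hb : IsFrame S.X₁ U b) (c : κ → Γ(S.X₂, U))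
    (hc : IsFrame S.X₃ U fun k => S.g.app U (c k)) :
    IsFrame S.X₂ U (Sum.elim (fun i => S.f.app U (b i)) c) := by
  have := hS.mono_f
  intro W h
  have hfg : ∀ t : Γ(S.X₁, W), S.g.app W (S.f.app W t) = 0 := by
    intro t
    rw [← ConcreteCategory.comp_apply, ← Scheme.Modules.Hom.comp_app, S.zero]
    rfl
  have hsum : ∀ a : ι ⊕ κ → Γ(X, W),
      ∑ i, a i • rs S.X₂ h (Sum.elim (fun i => S.f.app U (b i)) c i) =
      S.f.app W (∑ i, a (.inl i) • rs S.X₁ h (b i)) +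
      ∑ k, a (.inr k) • rs S.X₂ h (c k) := by
    intro a
    simp [Fintype.sum_sum_type, app_rs]
  have hg : ∀ a : κ → Γ(X, W), S.g.app W (∑ k, a k • rs S.X₂ h (c k)) =
      ∑ k, a k • rs S.X₃ h (S.g.app U (c k)) := by
    intro a
    simp [app_rs]
  constructor
  · intro a a' e
    simp only [hsum] at e
    have e2 := congrArg (S.g.app W) e
    simp only [map_add, hfg, zero_add, hg] at e2
    have h2 := hc.coord_ext h e2
    have h3 : ∀ k, a (.inr k) = a' (.inr k) := congrFun h2
    simp only [h3, add_left_inj] at e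
    have h4 := hb.coord_ext h (injective_of_mono S.f W e)
    ext (i | k)
    · exact congrFun h4 i
    · exact h3 k
  · intro s
    obtain ⟨a, ha⟩ := hc.exists_coord h (S.g.app W s)
    -- After subtracting a combination of the lifts with the same image, `s` lies in the kernel,
    -- hence comes from the sub.
    obtain ⟨t, ht⟩ := exists_app_eq_of_exact hS.exact (s - ∑ k, a k • rs S.X₂ h (c k)) (by
      rw [map_sub, hg, ha, sub_self])
    obtain ⟨a', rfl⟩ := hb.exists_coord h t
    refine ⟨Sum.elim a' a, ?_⟩
    simp only [hsum, Sum.elim_inl, Sum.elim_inr]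
    rw [ht, sub_add_cancel]

/-- If the image of a frame of the sub belongs to a frame of the middle term, the remaining sections
give a frame of the quotient. -/
theorem bijective_quotient {S : ShortComplex X.Modules} (hS : S.ShortExact) {ι κ : Type*}
    [Fintype ι] [Fintype κ] {b : ι → Γ(S.X₁, U)} (hb : IsFrame S.X₁ U b) (c : κ → Γ(S.X₂, U))
    (hc : IsFrame S.X₂ U (Sum.elim (fun i => S.f.app U (b i)) c))
    (hsurj : Function.Surjective (S.g.app U)) :
    Function.Bijective fun a : κ → Γ(X, U) => ∑ k, a k • S.g.app U (c k) := by
  have := hS.mono_f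
  have hfg : ∀ t : Γ(S.X₁, U), S.g.app U (S.f.app U t) = 0 := by
    intro t
    rw [← ConcreteCategory.comp_apply, ← Scheme.Modules.Hom.comp_app, S.zero]
    rfl
  constructor
  · intro a a' e
    simp only [← app_sum] at e
    obtain ⟨t, ht⟩ := exists_app_eq_of_exact hS.exact (∑ k, a k • c k - ∑ k, a' k • c k) (by
      rw [map_sub, e, sub_self])
    obtain ⟨β, hβ⟩ := hb.bijective.2 t
    -- The same section is expanded in two ways in the frame `hc`; comparing coefficients gives `a =
    -- a'`.
    have e1 : Sum.elim β a' = Sum.elim (fun _ => 0) a := by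
      apply hc.bijective.1
      simp only [Fintype.sum_sum_type, Sum.elim_inl, Sum.elim_inr, ← app_sum,
        zero_smul, Finset.sum_const_zero, zero_add]
      simp only at hβ
      rw [hβ, ht, sub_add_cancel]
    exact funext fun k => (congrFun e1 (.inr k)).symm
  · intro s
    obtain ⟨t, rfl⟩ := hsurj s
    obtain ⟨a, rfl⟩ := hc.bijective.2 t
    refine ⟨fun k => a (.inr k), ?_⟩
    simp only [Fintype.sum_sum_type, Sum.elim_inl, Sum.elim_inr, ← app_sum, map_add, hfg, zero_add]

end Exact

attribute [local instance] MvPolynomial.gradedAlgebra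

/-! ### Degree-zero fractions as polynomials and Laurent polynomials -/

section Coordinates

variable (K : Type u) [Field K]

/-- The grading of the homogeneous coordinate ring of the projective line. -/
abbrev grading : ℕ → Submodule K (MvPolynomial (Fin 2) K) :=
  MvPolynomial.homogeneousSubmodule (Fin 2) K

variable {K}

theorem aeval_mul_of_isHomogeneous {σ B : Type*} [CommRing B] [Algebra K B] {a : MvPolynomial σ K}
    {n : ℕ} (ha : a.IsHomogeneous n) (c : B) (v : σ → B) :
    MvPolynomial.aeval (fun k => c * v k) a = c ^ n * MvPolynomial.aeval v a := by
  simp only [MvPolynomial.aeval_def, MvPolynomial.eval₂_eq, Finset.mul_sum]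
  refine Finset.sum_congr rfl fun d hd => ?_
  have hdeg : d.degree = n := by
    by_contra h
    exact MvPolynomial.mem_support_iff.1 hd (ha.coeff_eq_zero h)
  simp only [mul_pow, Finset.prod_mul_distrib, Finset.prod_pow_eq_pow_sum]
  rw [← Finsupp.degree_apply, hdeg]
  ring

section AwayEval

variable {B : Type*} [CommRing B] [Algebra K B] {f : MvPolynomial (Fin 2) K} (v : Fin 2 → B)

/-- Evaluation of a fraction of degree zero at a point. -/
def awayEval (hu : IsUnit (MvPolynomial.aeval v f)) :
    HomogeneousLocalization.Away (grading K) f →+* B :=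
  (Localization.awayLift (MvPolynomial.aeval v).toRingHom f hu).comp
    (algebraMap (HomogeneousLocalization.Away (grading K) f) (Localization.Away f))

/-- Multiplying by the denominator avoids naming an inverse of the unit. -/
theorem awayEval_mk (hu : IsUnit (MvPolynomial.aeval v f)) {d : ℕ} (hf : f ∈ grading K d) (n : ℕ)
    (a : MvPolynomial (Fin 2) K) (ha : a ∈ grading K (n • d)) :
    awayEval v hu (.mk _ hf n a ha) * MvPolynomial.aeval v f ^ n = MvPolynomial.aeval v a := by
  obtain ⟨w, hw⟩ := isUnit_iff_exists_inv.1 hu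
  have h : awayEval v hu (.mk _ hf n a ha) = MvPolynomial.aeval v a * w ^ n :=
    Localization.awayLift_mk (MvPolynomial.aeval v).toRingHom f a w hw n
  rw [h, mul_assoc, ← mul_pow, mul_comm w, hw, one_pow, mul_one]

theorem awayEval_injective (hu : IsUnit (MvPolynomial.aeval v f)) {d : ℕ} (hf : f ∈ grading K d)
    (hv : ∀ (n : ℕ) (a : MvPolynomial (Fin 2) K), a ∈ grading K n →
      MvPolynomial.aeval v a = 0 → a = 0) : Function.Injective (awayEval v hu) := by
  rw [injective_iff_map_eq_zero]
  intro z hz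
  obtain ⟨n, a, ha, rfl⟩ := HomogeneousLocalization.Away.mk_surjective _ hf z
  have h := awayEval_mk v hu hf n a ha
  rw [hz, zero_mul] at h
  obtain rfl := hv _ a ha h.symm
  ext
  simp [Localization.mk_zero]

theorem C_mem_range_awayEval (hu : IsUnit (MvPolynomial.aeval v f)) {d : ℕ}
    (hf : f ∈ grading K d) (c : K) : algebraMap K B c ∈ (awayEval v hu).range := by
  refine ⟨.mk _ hf 0 (MvPolynomial.C c) ?_, ?_⟩
  · rw [zero_smul]
    exact MvPolynomial.isHomogeneous_C _ c
  · have h := awayEval_mk v hu hf 0 (MvPolynomial.C c)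
      (by rw [zero_smul]; exact MvPolynomial.isHomogeneous_C _ c)
    simpa using h

/-- Homogeneous polynomials are determined by their restriction to an affine chart. -/
theorem eq_zero_of_aeval_eq_zero (i : Fin 2)
    (ψ : B →ₐ[K] FractionRing (MvPolynomial (Fin 2) K))
    (hψ : ∀ k, algebraMap (MvPolynomial (Fin 2) K) (FractionRing (MvPolynomial (Fin 2) K))
      (MvPolynomial.X i) * ψ (v k) = algebraMap (MvPolynomial (Fin 2) K) _ (MvPolynomial.X k))
    (n : ℕ) (a : MvPolynomial (Fin 2) K)
    (ha : a ∈ grading K n) (h : MvPolynomial.aeval v a = 0) : a = 0 := by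
  let F := FractionRing (MvPolynomial (Fin 2) K)
  -- By homogeneity `a(x) = xᵢ ^ n ψ(a(v))`, because `xᵢ ψ(v k) = x k`; the right-hand side
  -- vanishes.
  have h1 : MvPolynomial.aeval
      (fun k => algebraMap (MvPolynomial (Fin 2) K) F (MvPolynomial.X i) * ψ (v k)) a = 0 := by
    rw [aeval_mul_of_isHomogeneous ha]
    have : MvPolynomial.aeval (fun k => ψ (v k)) a = ψ (MvPolynomial.aeval v a) :=
      (MvPolynomial.comp_aeval_apply v ψ a).symm
    rw [this, h, map_zero, mul_zero]
  rw [funext hψ] at h1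
  have h2 : MvPolynomial.aeval
      (fun k => algebraMap (MvPolynomial (Fin 2) K) F (MvPolynomial.X k)) a = algebraMap (MvPolynomial (Fin 2) K) F a := by
    have := MvPolynomial.aeval_algebraMap_apply F
      (MvPolynomial.X : Fin 2 → MvPolynomial (Fin 2) K) a
    rwa [MvPolynomial.aeval_X_left_apply] at this
  rw [h2] at h1
  exact (FaithfulSMul.algebraMap_injective _ F) (h1.trans (map_zero _).symm)

end AwayEval

open Polynomial

theorem isUnit_aeval_X_zero : IsUnit (MvPolynomial.aeval ![1, (X : K[X])]
    (MvPolynomial.X 0 : MvPolynomial (Fin 2) K)) := by simp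

theorem isUnit_aeval_X_one : IsUnit (MvPolynomial.aeval ![(X : K[X]), 1]
    (MvPolynomial.X 1 : MvPolynomial (Fin 2) K)) := by simp

theorem isUnit_aeval_X_mul_X :
    IsUnit (MvPolynomial.aeval ![(LaurentPolynomial.T 1 : LaurentPolynomial K), 1]
      (MvPolynomial.X 0 * MvPolynomial.X 1 : MvPolynomial (Fin 2) K)) := by
  simpa using LaurentPolynomial.isUnit_T 1

theorem X_mem_grading (i : Fin 2) : (MvPolynomial.X i : MvPolynomial (Fin 2) K) ∈ grading K 1 :=
  MvPolynomial.isHomogeneous_X _ i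

theorem X_mul_X_mem_grading :
    (MvPolynomial.X 0 * MvPolynomial.X 1 : MvPolynomial (Fin 2) K) ∈ grading K (1 + 1) :=
  (X_mem_grading 0).mul (X_mem_grading 1)

theorem X_pow_mem_grading (i : Fin 2) (n : ℕ) :
    (MvPolynomial.X i ^ n : MvPolynomial (Fin 2) K) ∈ grading K n :=
  MvPolynomial.isHomogeneous_X_pow i n

/-- Injectivity is tested in the function field by sending `X` to `x₁ / x₀`. The range is a subring
containing the constants and the image `X` of `x₁ / x₀`. -/
theorem awayEval_zero_bijective :
    Function.Bijective (awayEval ![1, (X : K[X])] isUnit_aeval_X_zero) := by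
  let F := FractionRing (MvPolynomial (Fin 2) K)
  have hX : algebraMap (MvPolynomial (Fin 2) K) F (MvPolynomial.X 0) ≠ 0 := by simp
  constructor
  · refine awayEval_injective _ _ (X_mem_grading 0) (eq_zero_of_aeval_eq_zero _ 0
      (Polynomial.aeval (algebraMap (MvPolynomial (Fin 2) K) F (MvPolynomial.X 1) /
        algebraMap (MvPolynomial (Fin 2) K) F (MvPolynomial.X 0))) ?_)
    intro k
    fin_cases k
    · simp
    · simpa using mul_div_cancel₀ _ hX
  · have hsub : ∀ p : K[X], p ∈ (awayEval ![1, (X : K[X])] isUnit_aeval_X_zero).range := by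
      have hC := C_mem_range_awayEval ![1, (X : K[X])] isUnit_aeval_X_zero (X_mem_grading 0)
      intro p
      induction p using Polynomial.induction_on' with
      | add p q hp hq => exact add_mem hp hq
      | monomial n c =>
        rw [← Polynomial.C_mul_X_pow_eq_monomial]
        have hX : X ∈ (awayEval ![1, (X : K[X])] isUnit_aeval_X_zero).range :=
          ⟨.mk _ (X_mem_grading 0) 1 (MvPolynomial.X 1) (X_mem_grading 1), by
            simpa using awayEval_mk ![1, (X : K[X])] isUnit_aeval_X_zero
              (X_mem_grading 0) 1 (MvPolynomial.X 1) (X_mem_grading 1)⟩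
        exact mul_mem (hC c) (pow_mem hX n)
    exact hsub

theorem awayEval_one_bijective :
    Function.Bijective (awayEval ![(X : K[X]), 1] isUnit_aeval_X_one) := by
  let F := FractionRing (MvPolynomial (Fin 2) K)
  have hX : algebraMap (MvPolynomial (Fin 2) K) F (MvPolynomial.X 1) ≠ 0 := by simp
  constructor
  · refine awayEval_injective _ _ (X_mem_grading 1) (eq_zero_of_aeval_eq_zero _ 1
      (Polynomial.aeval (algebraMap (MvPolynomial (Fin 2) K) F (MvPolynomial.X 0) /
        algebraMap (MvPolynomial (Fin 2) K) F (MvPolynomial.X 1))) ?_)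
    intro k
    fin_cases k
    · simpa using mul_div_cancel₀ _ hX
    · simp
  · have hsub : ∀ p : K[X], p ∈ (awayEval ![(X : K[X]), 1] isUnit_aeval_X_one).range := by
      have hC := C_mem_range_awayEval ![(X : K[X]), 1] isUnit_aeval_X_one (X_mem_grading 1)
      intro p
      induction p using Polynomial.induction_on' with
      | add p q hp hq => exact add_mem hp hq
      | monomial n c =>
        rw [← Polynomial.C_mul_X_pow_eq_monomial]
        have hX : X ∈ (awayEval ![(X : K[X]), 1] isUnit_aeval_X_one).range :=
          ⟨.mk _ (X_mem_grading 1) 1 (MvPolynomial.X 0) (X_mem_grading 0), by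
            simpa using awayEval_mk ![(X : K[X]), 1] isUnit_aeval_X_one
              (X_mem_grading 1) 1 (MvPolynomial.X 0) (X_mem_grading 0)⟩
        exact mul_mem (hC c) (pow_mem hX n)
    exact hsub

theorem aeval_T_eq (a : MvPolynomial (Fin 2) K) :
    MvPolynomial.aeval ![(LaurentPolynomial.T 1 : LaurentPolynomial K), 1] a =
      toLaurent (MvPolynomial.aeval ![(X : K[X]), 1] a) := by
  have : MvPolynomial.aeval ![(LaurentPolynomial.T 1 : LaurentPolynomial K), 1] =
      (toLaurentAlg (R := K)).comp (MvPolynomial.aeval ![(X : K[X]), 1]) := by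
    ext k : 1
    fin_cases k <;> simp
  exact DFunLike.congr_fun this a

/-- The fraction `x₀ ^ a x₁ ^ b / (x₀ x₁) ^ n`. -/
def monomialFraction (n a b : ℕ) (h : a + b = n • (1 + 1)) :
    HomogeneousLocalization.Away (grading K) (MvPolynomial.X 0 * MvPolynomial.X 1) :=
  .mk _ X_mul_X_mem_grading n (MvPolynomial.X 0 ^ a * MvPolynomial.X 1 ^ b)
    (h ▸ (X_pow_mem_grading 0 a).mul (X_pow_mem_grading 1 b))

theorem awayEval_monomialFraction (n a b : ℕ) (h : a + b = n • (1 + 1)) :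
    awayEval ![(LaurentPolynomial.T 1 : LaurentPolynomial K), 1] isUnit_aeval_X_mul_X
      (monomialFraction n a b h) = LaurentPolynomial.T ((a : ℤ) - n) := by
  have := awayEval_mk ![(LaurentPolynomial.T 1 : LaurentPolynomial K), 1] isUnit_aeval_X_mul_X
    X_mul_X_mem_grading n (MvPolynomial.X 0 ^ a * MvPolynomial.X 1 ^ b)
    (h ▸ (X_pow_mem_grading 0 a).mul (X_pow_mem_grading 1 b))
  simp only [map_mul, MvPolynomial.aeval_X, map_pow, Matrix.cons_val_zero, Matrix.cons_val_one,
    one_pow, mul_one, LaurentPolynomial.T_pow] at this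
  rw [LaurentPolynomial.T_sub, ← this, mul_assoc, ← LaurentPolynomial.T_add]
  simp [monomialFraction]

theorem awayEval_zero_one_bijective :
    Function.Bijective (awayEval ![(LaurentPolynomial.T 1 : LaurentPolynomial K), 1]
      isUnit_aeval_X_mul_X) := by
  let F := FractionRing (MvPolynomial (Fin 2) K)
  have hX : algebraMap (MvPolynomial (Fin 2) K) F (MvPolynomial.X 1) ≠ 0 := by simp
  constructor
  · refine awayEval_injective _ _ X_mul_X_mem_grading fun n a ha h => ?_
    rw [aeval_T_eq, toLaurent_eq_zero] at h
    refine eq_zero_of_aeval_eq_zero _ 1 (Polynomial.aeval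
      (algebraMap (MvPolynomial (Fin 2) K) F (MvPolynomial.X 0) /
        algebraMap (MvPolynomial (Fin 2) K) F (MvPolynomial.X 1))) ?_ n a ha h
    intro k
    fin_cases k
    · simpa using mul_div_cancel₀ _ hX
    · simp
  · have hsub : ∀ p : LaurentPolynomial K, p ∈ (awayEval
        ![(LaurentPolynomial.T 1 : LaurentPolynomial K), 1] isUnit_aeval_X_mul_X).range := by
      intro p
      induction p using LaurentPolynomial.induction_on' with
      | add p q hp hq => exact add_mem hp hq
      | C_mul_T n c =>
        refine mul_mem (C_mem_range_awayEval _ _ X_mul_X_mem_grading c)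
          -- The exponents `|n| + n` and `|n| - n` are nonnegative with sum `2 |n|`; dividing by
          -- `(x₀ x₁) ^ |n|` leaves `T ^ n`.
          ⟨monomialFraction n.natAbs (n.natAbs + n).toNat (n.natAbs - n).toNat ?_, ?_⟩
        · simp only [smul_eq_mul]
          omega
        · rw [awayEval_monomialFraction]
          congr 1
          omega
    exact hsub

/-- Restriction from the chart `x₁ ≠ 0` in coordinates. -/
theorem awayEval_awayMap_one (z : HomogeneousLocalization.Away (grading K) (MvPolynomial.X 1)) :
    awayEval ![(LaurentPolynomial.T 1 : LaurentPolynomial K), 1] isUnit_aeval_X_mul_X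
      (HomogeneousLocalization.awayMap (grading K) (X_mem_grading 0) (mul_comm _ _) z) =
      toLaurent (awayEval ![(X : K[X]), 1] isUnit_aeval_X_one z) := by
  obtain ⟨n, a, ha, rfl⟩ := HomogeneousLocalization.Away.mk_surjective _ (X_mem_grading 1) z
  rw [HomogeneousLocalization.awayMap_mk]
  have h1 := awayEval_mk ![(X : K[X]), 1] isUnit_aeval_X_one (X_mem_grading 1) n a ha
  have h2 := awayEval_mk ![(LaurentPolynomial.T 1 : LaurentPolynomial K), 1] isUnit_aeval_X_mul_X
    X_mul_X_mem_grading n (a * MvPolynomial.X 0 ^ n) (by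
      rw [smul_add]
      exact ha.mul (by simpa using X_pow_mem_grading 0 n))
  simp only [map_mul, map_pow, MvPolynomial.aeval_X, Matrix.cons_val_zero, Matrix.cons_val_one,
    one_pow, mul_one] at h1 h2
  rw [h1, ← aeval_T_eq]
  exact ((LaurentPolynomial.isUnit_T 1).pow n).mul_right_cancel h2

/-- Restriction from the chart `x₀ ≠ 0` in coordinates. -/
theorem awayEval_awayMap_zero (z : HomogeneousLocalization.Away (grading K) (MvPolynomial.X 0)) :
    awayEval ![(LaurentPolynomial.T 1 : LaurentPolynomial K), 1] isUnit_aeval_X_mul_X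
      (HomogeneousLocalization.awayMap (grading K) (X_mem_grading 1) rfl z) =
      LaurentPolynomial.invert (toLaurent (awayEval ![1, (X : K[X])] isUnit_aeval_X_zero z)) := by
  obtain ⟨n, a, ha, rfl⟩ := HomogeneousLocalization.Away.mk_surjective _ (X_mem_grading 0) z
  rw [HomogeneousLocalization.awayMap_mk]
  have h1 := awayEval_mk ![1, (X : K[X])] isUnit_aeval_X_zero (X_mem_grading 0) n a ha
  have h2 := awayEval_mk ![(LaurentPolynomial.T 1 : LaurentPolynomial K), 1] isUnit_aeval_X_mul_X
    X_mul_X_mem_grading n (a * MvPolynomial.X 1 ^ n) (by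
      rw [smul_add]
      exact ha.mul (by simpa using X_pow_mem_grading 1 n))
  simp only [map_mul, map_pow, MvPolynomial.aeval_X, Matrix.cons_val_zero, Matrix.cons_val_one,
    one_pow, mul_one] at h1 h2
  let ψ : K[X] →ₐ[K] LaurentPolynomial K :=
    (LaurentPolynomial.invert (R := K)).toAlgHom.comp toLaurentAlg
  -- Homogeneity applied to `(T, 1) = T • (1, T⁻¹)`.
  have h3 : MvPolynomial.aeval ![(LaurentPolynomial.T 1 : LaurentPolynomial K), 1] a =
      LaurentPolynomial.T 1 ^ n * ψ (MvPolynomial.aeval ![1, (X : K[X])] a) := by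
    rw [MvPolynomial.comp_aeval_apply, ← aeval_mul_of_isHomogeneous (by simpa using ha)]
    congr 2
    funext k
    fin_cases k
    · simp [ψ]
    · have : (LaurentPolynomial.T 1 * LaurentPolynomial.T (-1) : LaurentPolynomial K) = 1 := by
        rw [← LaurentPolynomial.T_add, add_neg_cancel, LaurentPolynomial.T_zero]
      simp [ψ, this]
  rw [h1]
  refine ((LaurentPolynomial.isUnit_T 1).pow n).mul_right_cancel (h2.trans (h3.trans ?_))
  rw [mul_comm]
  rfl

end Coordinates

/-! ### Local trivializations of the twisting sheaves -/

section TwistFrames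

variable {A σ : Type u} [CommRing A] [SetLike σ A] [AddSubgroupClass σ A]
variable (𝒜 : ℕ → σ) [GradedRing 𝒜] (d : ℤ)

/-- The value of a section of a twisting sheaf at a point. -/
def twistEval {U : (Proj 𝒜).Opens} (s : Γ(twist 𝒜 d, U)) (x : ProjectiveSpectrum 𝒜) (hx : x ∈ U) :
    LocAt 𝒜 x :=
  Subtype.val (p := fun f => f ∈ twistSections 𝒜 d U) s ⟨x, hx⟩

/-- The value of a function at a point. -/
def projEval {U : (Proj 𝒜).Opens} (s : Γ(Proj 𝒜, U)) (x : ProjectiveSpectrum 𝒜) (hx : x ∈ U) :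
    HomogeneousLocalization.AtPrime 𝒜 x.asHomogeneousIdeal.toIdeal :=
  (show (ProjectiveSpectrum.Proj.structureSheaf 𝒜).1.obj (op U) from s).1 ⟨x, hx⟩

variable {𝒜} {d} {U W : (Proj 𝒜).Opens}

theorem twistEval_ext {s t : Γ(twist 𝒜 d, U)}
    (h : ∀ x hx, twistEval 𝒜 d s x hx = twistEval 𝒜 d t x hx) : s = t :=
  Subtype.ext (p := fun f => f ∈ twistSections 𝒜 d U) (funext fun x => h x.1 x.2)

theorem projEval_ext {s t : Γ(Proj 𝒜, U)}
    (h : ∀ x hx, projEval 𝒜 s x hx = projEval 𝒜 t x hx) : s = t :=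
  Proj.ext 𝒜 (V := op U) s t (funext fun x => h x.1 x.2)

theorem twistEval_smul (a : Γ(Proj 𝒜, U)) (s : Γ(twist 𝒜 d, U)) (x : ProjectiveSpectrum 𝒜)
    (hx : x ∈ U) : twistEval 𝒜 d (a • s) x hx = (projEval 𝒜 a x hx).val * twistEval 𝒜 d s x hx :=
  rfl

variable (d) in
/-- The section `f ^ d` of `𝒪(d)` over the set where `f` does not vanish. -/
def twistPow {f : A} (hf : f ∈ 𝒜 1) : Γ(twist 𝒜 d, Proj.basicOpen 𝒜 f) :=
  show twistSections 𝒜 d (Proj.basicOpen 𝒜 f) from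
  -- At least one of the exponents `d.toNat`, `(-d).toNat` is zero, so this is `f ^ d` for either
  -- sign of `d`.
  ⟨fun x => Localization.mk (f ^ d.toNat)
      ⟨f ^ (-d).toNat, pow_mem (show f ∈ complAt 𝒜 x.1 from x.2) _⟩,
    fun x => ⟨Proj.basicOpen 𝒜 f, x.2, 𝟙 _, d.toNat, (-d).toNat,
      ⟨f ^ d.toNat, by simpa using SetLike.pow_mem_graded d.toNat hf⟩,
      ⟨f ^ (-d).toNat, by simpa using SetLike.pow_mem_graded (-d).toNat hf⟩, by omega,
      fun y => ⟨pow_mem (show f ∈ complAt 𝒜 y.1 from y.2) _, rfl⟩⟩⟩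

theorem twistEval_twistPow {f : A} (hf : f ∈ 𝒜 1) (x : ProjectiveSpectrum 𝒜)
    (hx : x ∈ Proj.basicOpen 𝒜 f) : twistEval 𝒜 d (twistPow d hf) x hx =
      Localization.mk (f ^ d.toNat)
        ⟨f ^ (-d).toNat, pow_mem (show f ∈ complAt 𝒜 x from hx) _⟩ := rfl

theorem isUnit_twistEval_twistPow {f : A} (hf : f ∈ 𝒜 1) (x : ProjectiveSpectrum 𝒜)
    (hx : x ∈ Proj.basicOpen 𝒜 f) : IsUnit (twistEval 𝒜 d (twistPow d hf) x hx) := by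
  have hx' : f ∈ complAt 𝒜 x := hx
  refine IsUnit.of_mul_eq_one
    (Localization.mk (f ^ (-d).toNat) ⟨f ^ d.toNat, pow_mem hx' _⟩) ?_
  rw [twistEval_twistPow, Localization.mk_mul]
  have h : f ^ d.toNat * f ^ (-d).toNat ∈ complAt 𝒜 x :=
    mul_mem (pow_mem hx' _) (pow_mem hx' _)
  convert Localization.mk_self (⟨_, h⟩ : complAt 𝒜 x) using 2
  exact Subtype.ext (mul_comm _ _)

/-- The sheaf `𝒪(d)` is trivialized by `f ^ d` where `f` does not vanish. -/
theorem isFrame_twistPow {f : A} (hf : f ∈ 𝒜 1) :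
    IsFrame (twist 𝒜 d) (Proj.basicOpen 𝒜 f) fun _ : Unit => twistPow d hf := by
  intro W h
  simp only [Finset.univ_unique, Finset.sum_singleton]
  constructor
  · intro a a' e
    funext i
    refine projEval_ext fun x hx => HomogeneousLocalization.val_injective _ ?_
    have := congrArg (fun s => twistEval 𝒜 d s x hx) e
    exact (isUnit_twistEval_twistPow hf x (h hx)).mul_right_cancel this
  · intro s
    have hx' : ∀ x : ProjectiveSpectrum 𝒜, x ∈ W → f ∈ complAt 𝒜 x := fun x hx => h hx
    -- A fraction of degree `d` divided by `f ^ d` is a fraction of degree zero. The numerator and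
    -- denominator are chosen before the point, so they serve on a whole neighbourhood.
    have key : ∀ (i j : ℕ) (a : 𝒜 i) (b : 𝒜 j) (_ : (i : ℤ) - j = d),
        ∃ (m : ℕ) (a' b' : 𝒜 m), ∀ (y : ProjectiveSpectrum 𝒜) (hy : y ∈ W)
          (hb : (b : A) ∈ complAt 𝒜 y), ∃ hb' : (b' : A) ∈ complAt 𝒜 y,
            (HomogeneousLocalization.mk ⟨m, a', b', hb'⟩ :
              HomogeneousLocalization 𝒜 (complAt 𝒜 y)).val *
              twistEval 𝒜 d (twistPow d hf) y (h hy) = Localization.mk (a : A) ⟨b, hb⟩ := by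
      intro i j a b hij
      refine ⟨i + (-d).toNat, ⟨a * f ^ (-d).toNat, SetLike.mul_mem_graded a.2 ?_⟩,
        ⟨b * f ^ d.toNat, ?_⟩, fun y hy hb => ⟨mul_mem hb (pow_mem (hx' y hy) _), ?_⟩⟩
      · simpa using SetLike.pow_mem_graded (-d).toNat hf
      · rw [show i + (-d).toNat = j + d.toNat by omega]
        exact SetLike.mul_mem_graded b.2 (by simpa using SetLike.pow_mem_graded d.toNat hf)
      · rw [twistEval_twistPow, HomogeneousLocalization.val_mk, Localization.mk_mul,
          Localization.mk_eq_mk_iff, Localization.r_iff_exists]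
        refine ⟨1, ?_⟩
        simp only [Submonoid.coe_one, one_mul, Submonoid.coe_mul]
        ring
    have hloc := (show twistSections 𝒜 d W from s).2
    have hs : ∀ x : W, ∃ g : HomogeneousLocalization 𝒜 (complAt 𝒜 x.1),
        g.val * twistEval 𝒜 d (twistPow d hf) x.1 (h x.2) = twistEval 𝒜 d s x.1 x.2 := by
      intro x
      obtain ⟨V, hxV, iV, i, j, a, b, hij, w⟩ := hloc x
      obtain ⟨m, a', b', hab⟩ := key i j a b hij
      obtain ⟨hb, e⟩ := w ⟨x.1, hxV⟩
      obtain ⟨hb', e'⟩ := hab x.1 x.2 hb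
      exact ⟨_, e'.trans e.symm⟩
    choose g hg using hs
    refine ⟨fun _ => show (ProjectiveSpectrum.Proj.structureSheaf 𝒜).1.obj (op W) from
      ⟨g, fun x => ?_⟩, twistEval_ext fun x hx => hg ⟨x, hx⟩⟩
    -- The pointwise quotients `g` are uniquely determined, since `f ^ d` is a unit at each point;
    -- near `x` they therefore agree with one fraction.
    obtain ⟨V, hxV, iV, i, j, a, b, hij, w⟩ := hloc x
    obtain ⟨m, a', b', hab⟩ := key i j a b hij
    refine ⟨V, hxV, iV, m, a', b', fun y => ?_, fun y => ?_⟩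
    · obtain ⟨hb, -⟩ := w y
      exact (hab y.1 (iV.le y.2) hb).1
    · obtain ⟨hb, e⟩ := w y
      obtain ⟨hb', e'⟩ := hab y.1 (iV.le y.2) hb
      refine HomogeneousLocalization.val_injective _ ?_
      exact (isUnit_twistEval_twistPow hf y.1 (h (iV.le y.2))).mul_right_cancel
        ((hg ⟨y.1, iV.le y.2⟩).trans (e.trans e'.symm))

end TwistFrames

/-! ### The standard charts, their coordinates and the transition functions of `𝒪(d)` -/

section Charts

open Polynomial

variable (K : Type u) [Field K]

/-- The open set `x₀ ≠ 0`. -/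
def chartZero : (P1 K).Opens := Proj.basicOpen (grading K) (MvPolynomial.X 0)

/-- The open set `x₁ ≠ 0`. -/
def chartOne : (P1 K).Opens := Proj.basicOpen (grading K) (MvPolynomial.X 1)

theorem basicOpen_X_mul_X : Proj.basicOpen (grading K) (MvPolynomial.X 0 * MvPolynomial.X 1) =
    chartZero K ⊓ chartOne K := Proj.basicOpen_mul ..

theorem isAffineOpen_chartZero : IsAffineOpen (chartZero K) :=
  Proj.isAffineOpen_basicOpen _ _ (X_mem_grading 0) one_pos

theorem isAffineOpen_chartOne : IsAffineOpen (chartOne K) :=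
  Proj.isAffineOpen_basicOpen _ _ (X_mem_grading 1) one_pos

/-- The coordinate ring is generated by `x₀` and `x₁` over its degree-zero part, so the two do not
vanish together. -/
theorem top_le_chart_sup : (⊤ : (P1 K).Opens) ≤ chartZero K ⊔ chartOne K := by
  have h := Proj.iSup_basicOpen_eq_top' (grading K)
    (MvPolynomial.X : Fin 2 → MvPolynomial (Fin 2) K)
    (fun i => ⟨1, X_mem_grading i⟩) (by
      refine eq_top_iff.2 fun p _ => ?_
      induction p using MvPolynomial.induction_on with
      | C c =>
        exact Subalgebra.algebraMap_mem _ (⟨MvPolynomial.C c, MvPolynomial.isHomogeneous_C _ c⟩ :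
          grading K 0)
      | add p q hp hq => exact add_mem (hp trivial) (hq trivial)
      | mul_X p i hp => exact mul_mem (hp trivial) (Algebra.subset_adjoin ⟨i, rfl⟩))
  rw [← h]
  refine iSup_le fun i => ?_
  fin_cases i
  · exact le_sup_left
  · exact le_sup_right

variable {K} in
/-- Functions on the complement of a homogeneous hypersurface. -/
def sectionEquiv {f : MvPolynomial (Fin 2) K} {d : ℕ} (hf : f ∈ grading K d) (hd : 0 < d) :
    HomogeneousLocalization.Away (grading K) f ≃+* Γ(P1 K, Proj.basicOpen (grading K) f) :=
  (Proj.basicOpenIsoAway (grading K) f hf hd).commRingCatIsoToRingEquiv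

/-- The coordinate `x₁ / x₀` where `x₀ ≠ 0`. -/
def coordZero : Γ(P1 K, chartZero K) ≃+* K[X] :=
  (sectionEquiv (X_mem_grading 0) one_pos).symm.trans (.ofBijective _ awayEval_zero_bijective)

/-- The coordinate `x₀ / x₁` where `x₁ ≠ 0`. -/
def coordOne : Γ(P1 K, chartOne K) ≃+* K[X] :=
  (sectionEquiv (X_mem_grading 1) one_pos).symm.trans (.ofBijective _ awayEval_one_bijective)

/-- The ring isomorphism induced by an equality of open sets. -/
def roEquiv {X : Scheme.{u}} {U V : X.Opens} (h : U = V) : Γ(X, U) ≃+* Γ(X, V) :=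
  RingEquiv.ofRingHom (ro h.ge) (ro h.le) (by ext; simp [ro_ro]) (by ext; simp [ro_ro])

/-- The coordinate `x₀ / x₁` where `x₀ x₁ ≠ 0`. -/
def coordOverlap : Γ(P1 K, chartZero K ⊓ chartOne K) ≃+* LaurentPolynomial K :=
  (roEquiv (basicOpen_X_mul_X K)).symm.trans <|
    (sectionEquiv X_mul_X_mem_grading two_pos).symm.trans
      (.ofBijective _ awayEval_zero_one_bijective)

variable {K} in
theorem ro_sectionEquiv {f g x : MvPolynomial (Fin 2) K} {d e m : ℕ} (hf : f ∈ grading K d)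
    (hd : 0 < d) (hg : g ∈ grading K e) (hx : x = f * g) (hm : x ∈ grading K m) (hm' : 0 < m)
    (h : Proj.basicOpen (grading K) x ≤ Proj.basicOpen (grading K) f) (z) :
    ro h (sectionEquiv hf hd z) =
      sectionEquiv hm hm' (HomogeneousLocalization.awayMap (grading K) hg hx z) :=
  (ConcreteCategory.congr_hom (Proj.awayMap_awayToSection (grading K) hg hx) z).symm

theorem coordOverlap_ro_sectionEquiv (z) :
    coordOverlap K (ro (basicOpen_X_mul_X K).ge (sectionEquiv X_mul_X_mem_grading two_pos z)) =
      awayEval _ isUnit_aeval_X_mul_X z := by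
  have : ro (basicOpen_X_mul_X K).ge (sectionEquiv X_mul_X_mem_grading two_pos z) =
    roEquiv (basicOpen_X_mul_X K) (sectionEquiv X_mul_X_mem_grading two_pos z) := rfl
  simp only [this, coordOverlap, RingEquiv.trans_apply, RingEquiv.symm_apply_apply]
  rfl

/-- The overlap uses the coordinate `x₀ / x₁`, the inverse of the coordinate of this chart; hence
`invert`. -/
theorem coordOverlap_zero (z : Γ(P1 K, chartZero K)) :
    coordOverlap K (ro inf_le_left z) = LaurentPolynomial.invert (toLaurent (coordZero K z)) := by
  obtain ⟨z, rfl⟩ := (sectionEquiv (X_mem_grading 0) one_pos).surjective z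
  have h : coordZero K (sectionEquiv (X_mem_grading 0) one_pos z) =
      awayEval _ isUnit_aeval_X_zero z :=
    congrArg (awayEval _ isUnit_aeval_X_zero)
      ((sectionEquiv (X_mem_grading 0) one_pos).symm_apply_apply z)
  rw [h, ← awayEval_awayMap_zero, ← coordOverlap_ro_sectionEquiv,
    ← ro_sectionEquiv (X_mem_grading 0) one_pos (X_mem_grading 1) rfl X_mul_X_mem_grading two_pos
      (Proj.basicOpen_mono _ _ _ ⟨_, rfl⟩), ro_ro]
  rfl

theorem coordOverlap_one (z : Γ(P1 K, chartOne K)) :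
    coordOverlap K (ro inf_le_right z) = toLaurent (coordOne K z) := by
  obtain ⟨z, rfl⟩ := (sectionEquiv (X_mem_grading 1) one_pos).surjective z
  have h : coordOne K (sectionEquiv (X_mem_grading 1) one_pos z) =
      awayEval _ isUnit_aeval_X_one z :=
    congrArg (awayEval _ isUnit_aeval_X_one)
      ((sectionEquiv (X_mem_grading 1) one_pos).symm_apply_apply z)
  rw [h, ← awayEval_awayMap_one, ← coordOverlap_ro_sectionEquiv,
    ← ro_sectionEquiv (X_mem_grading 1) one_pos (X_mem_grading 0) (mul_comm _ _)
      X_mul_X_mem_grading two_pos (Proj.basicOpen_mono _ _ _ ⟨_, mul_comm _ _⟩), ro_ro]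
  rfl

variable (d : ℤ)

/-- The section `x₀ ^ d` of `𝒪(d)` where `x₀ ≠ 0`. -/
def powZero : Γ(O K d, chartZero K) := twistPow d (X_mem_grading 0)

/-- The section `x₁ ^ d` of `𝒪(d)` where `x₁ ≠ 0`. -/
def powOne : Γ(O K d, chartOne K) := twistPow d (X_mem_grading 1)

theorem isFrame_powZero : IsFrame (O K d) (chartZero K) fun _ : Unit => powZero K d :=
  isFrame_twistPow (X_mem_grading 0)

theorem isFrame_powOne : IsFrame (O K d) (chartOne K) fun _ : Unit => powOne K d :=
  isFrame_twistPow (X_mem_grading 1)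

theorem rs_powZero : rs (O K d) (inf_le_left : chartZero K ⊓ chartOne K ≤ _) (powZero K d) =
    (coordOverlap K).symm (LaurentPolynomial.T d) •
      rs (O K d) (inf_le_right : chartZero K ⊓ chartOne K ≤ _) (powOne K d) := by
  -- With `p = d.toNat` and `q = (-d).toNat`, the function `T ^ d` is `x₀ ^ (2p) x₁ ^ (2q) / (x₀ x₁)
  -- ^ (p + q)`, which makes sense for either sign of `d`.
  have : (LaurentPolynomial.T d : LaurentPolynomial K) =
      LaurentPolynomial.T (((d.toNat + d.toNat : ℕ) : ℤ) - (d.toNat + (-d).toNat : ℕ)) := by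
    congr 1
    omega
  rw [this, ← awayEval_monomialFraction _ _ ((-d).toNat + (-d).toNat) (by rw [smul_eq_mul]; omega)]
  rw [← coordOverlap_ro_sectionEquiv, RingEquiv.symm_apply_apply]
  refine twistEval_ext fun x hx => ?_
  rw [twistEval_smul]
  have h0 : MvPolynomial.X 0 ∈ complAt (grading K) x := hx.1
  have h1 : MvPolynomial.X 1 ∈ complAt (grading K) x := hx.2
  have key : (Localization.mk (MvPolynomial.X 0 ^ d.toNat)
      ⟨MvPolynomial.X 0 ^ (-d).toNat, pow_mem h0 _⟩ : LocAt (grading K) x) =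
      Localization.mk (MvPolynomial.X 0 ^ (d.toNat + d.toNat) *
        MvPolynomial.X 1 ^ ((-d).toNat + (-d).toNat))
        ⟨_, pow_mem (mul_mem h0 h1) (d.toNat + (-d).toNat)⟩ *
      Localization.mk (MvPolynomial.X 1 ^ d.toNat)
        ⟨MvPolynomial.X 1 ^ (-d).toNat, pow_mem h1 _⟩ := by
    rw [Localization.mk_mul, Localization.mk_eq_mk_iff, Localization.r_iff_exists]
    refine ⟨1, ?_⟩
    simp only [Submonoid.coe_one, one_mul, Submonoid.coe_mul]
    ring
  exact key

end Charts

/-! ### Units on the charts and on the overlap -/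

section LaurentUnits

open Polynomial

variable {K : Type u} [Field K]

/-- Clearing denominators turns `u v = 1` into `p q = X ^ (N + M)` for polynomials; as `X` is prime,
`p` is a constant times a power of `X`. -/
theorem exists_eq_C_mul_T_of_isUnit {u : LaurentPolynomial K} (hu : IsUnit u) :
    ∃ (c : K) (n : ℤ), c ≠ 0 ∧ u = LaurentPolynomial.C c * LaurentPolynomial.T n := by
  obtain ⟨v, huv⟩ := isUnit_iff_exists_inv.1 hu
  obtain ⟨N, p, hp⟩ := u.exists_T_pow
  obtain ⟨M, q, hq⟩ := v.exists_T_pow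
  have h : p * q = X ^ (N + M) := by
    apply toLaurent_injective
    rw [map_mul, hp, hq, toLaurent_X_pow, Nat.cast_add, LaurentPolynomial.T_add]
    linear_combination (LaurentPolynomial.T (N : ℤ) * LaurentPolynomial.T (M : ℤ)) * huv
  obtain ⟨i, -, hi⟩ := (dvd_prime_pow prime_X _).1 (Dvd.intro q h)
  obtain ⟨w, hw⟩ := hi.symm
  obtain ⟨c, hc, hcw⟩ := Polynomial.isUnit_iff.1 w.isUnit
  refine ⟨c, i - N, hc.ne_zero, ?_⟩
  have h2 : u * LaurentPolynomial.T N = LaurentPolynomial.C c * LaurentPolynomial.T i := by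
    rw [← hp, ← hw, ← hcw, map_mul, toLaurent_X_pow, toLaurent_C, mul_comm]
  rw [LaurentPolynomial.T_sub, ← mul_assoc, ← h2, LaurentPolynomial.mul_T_assoc, add_neg_cancel,
    LaurentPolynomial.T_zero, mul_one]

variable (K) in
instance : IsDomain Γ(P1 K, chartZero K) := (coordZero K).toMulEquiv.isDomain

variable (K) in
instance : IsDomain Γ(P1 K, chartOne K) := (coordOne K).toMulEquiv.isDomain

variable (K) in
instance : IsPrincipalIdealRing Γ(P1 K, chartZero K) :=
  .of_surjective (coordZero K).symm (coordZero K).symm.surjective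

variable (K) in
instance : IsPrincipalIdealRing Γ(P1 K, chartOne K) :=
  .of_surjective (coordOne K).symm (coordOne K).symm.surjective

variable (K) in
-- The overlap carries a nonzero ring of functions, so it is not empty. A common point is what lets
-- ranks be compared.
theorem exists_mem_overlap : ∃ x, x ∈ chartZero K ⊓ chartOne K := by
  by_contra! h
  have h' : chartZero K ⊓ chartOne K = ⊥ := by
    ext x
    exact ⟨fun hx => (h x hx).elim, fun hx => hx.elim⟩
  have h1 : (1 : Γ(P1 K, chartZero K ⊓ chartOne K)) = 0 :=
    fun_eq_of_locally fun x hx => (h x hx).elim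
  have := congrArg (coordOverlap K) h1
  rw [map_one, map_zero] at this
  exact one_ne_zero this

/-- A function on the overlap of the charts which is a nonzero multiple of `(x₀ / x₁) ^ n`. -/
def IsMonomial (u : Γ(P1 K, chartZero K ⊓ chartOne K)) (n : ℤ) : Prop :=
  ∃ c : K, c ≠ 0 ∧ coordOverlap K u = LaurentPolynomial.C c * LaurentPolynomial.T n

variable {u v : Γ(P1 K, chartZero K ⊓ chartOne K)} {m n : ℤ}

theorem exists_isMonomial (hu : IsUnit u) : ∃ n, IsMonomial u n := by
  obtain ⟨c, n, hc, h⟩ := exists_eq_C_mul_T_of_isUnit (hu.map (coordOverlap K))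
  exact ⟨n, c, hc, h⟩

theorem IsMonomial.unique (hu : IsMonomial u m) (hu' : IsMonomial u n) : m = n := by
  obtain ⟨c, hc, h⟩ := hu
  obtain ⟨c', hc', h'⟩ := hu'
  have := congrArg LaurentPolynomial.degree (h.symm.trans h')
  rw [LaurentPolynomial.degree_C_mul_T _ _ hc, LaurentPolynomial.degree_C_mul_T _ _ hc'] at this
  exact_mod_cast this

theorem IsMonomial.mul (hu : IsMonomial u m) (hv : IsMonomial v n) :
    IsMonomial (u * v) (m + n) := by
  obtain ⟨c, hc, h⟩ := hu
  obtain ⟨c', hc', h'⟩ := hv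
  refine ⟨c * c', mul_ne_zero hc hc', ?_⟩
  rw [map_mul, h, h', map_mul, LaurentPolynomial.T_add]
  ring

theorem isMonomial_one : IsMonomial (1 : Γ(P1 K, chartZero K ⊓ chartOne K)) 0 :=
  ⟨1, one_ne_zero, by simp⟩

theorem isMonomial_symm_T (n : ℤ) :
    IsMonomial ((coordOverlap K).symm (LaurentPolynomial.T n)) n :=
  ⟨1, one_ne_zero, by simp⟩

theorem IsMonomial.prod {ι : Type*} (s : Finset ι) {u : ι → Γ(P1 K, chartZero K ⊓ chartOne K)}
    {n : ι → ℤ} (h : ∀ i, IsMonomial (u i) (n i)) :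
    IsMonomial (∏ i ∈ s, u i) (∑ i ∈ s, n i) := by
  classical
  induction s using Finset.induction_on with
  | empty => simpa using isMonomial_one
  | insert i s hi ih =>
    rw [Finset.prod_insert hi, Finset.sum_insert hi]
    exact (h i).mul ih

/-- Units of a polynomial ring over a field are constants. This is why the degree does not depend on
the frames. -/
theorem isMonomial_of_isUnit_zero {w : Γ(P1 K, chartZero K)} (hw : IsUnit w) :
    IsMonomial (ro inf_le_left w) 0 := by
  obtain ⟨c, hc, h⟩ := Polynomial.isUnit_iff.1 (hw.map (coordZero K))
  exact ⟨c, hc.ne_zero, by simp [coordOverlap_zero, ← h]⟩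

theorem isMonomial_of_isUnit_one {w : Γ(P1 K, chartOne K)} (hw : IsUnit w) :
    IsMonomial (ro inf_le_right w) 0 := by
  obtain ⟨c, hc, h⟩ := Polynomial.isUnit_iff.1 (hw.map (coordOne K))
  exact ⟨c, hc.ne_zero, by simp [coordOverlap_one, ← h]⟩

end LaurentUnits

/-! ### Rank and degree of vector bundles through transition matrices -/

section Degree

variable {K : Type u} [Field K]

/-- `E` is a locally free sheaf of rank `n` on the projective line, and the determinant of its
transition matrix between the standard charts has order `δ`. -/
def HasRankDegree (E : (P1 K).Modules) (n : ℕ) (δ : ℤ) : Prop :=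
  ∃ (b₀ : Fin n → Γ(E, chartZero K)) (b₁ : Fin n → Γ(E, chartOne K))
    (g : Matrix (Fin n) (Fin n) Γ(P1 K, chartZero K ⊓ chartOne K)),
    IsFrame E _ b₀ ∧ IsFrame E _ b₁ ∧
    IsTransition (fun i => rs E inf_le_right (b₁ i)) (fun i => rs E inf_le_left (b₀ i)) g ∧
    IsMonomial g.det δ

variable {E F : (P1 K).Modules} {n n' : ℕ} {δ δ' : ℤ}

theorem hasRankDegree_of_frames {ι : Type*} [Fintype ι] [DecidableEq ι]
    {b₀ : ι → Γ(E, chartZero K)} {b₁ : ι → Γ(E, chartOne K)}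
    {g : Matrix ι ι Γ(P1 K, chartZero K ⊓ chartOne K)} (h₀ : IsFrame E _ b₀) (h₁ : IsFrame E _ b₁)
    (hg : IsTransition (fun i => rs E inf_le_right (b₁ i)) (fun i => rs E inf_le_left (b₀ i)) g)
    (hδ : IsMonomial g.det δ) (hn : Fintype.card ι = n) : HasRankDegree E n δ := by
  obtain ⟨e⟩ : Nonempty (Fin n ≃ ι) := ⟨(Fintype.equivFinOfCardEq hn).symm⟩
  refine ⟨_, _, g.submatrix e e, h₀.reindex e, h₁.reindex e, fun k => ?_, ?_⟩
  · rw [hg (e k), ← e.sum_comp]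
    rfl
  · rwa [Matrix.det_submatrix_equiv_self]

theorem IsFrame.card_eq_of_overlap {ι κ : Type*} [Fintype ι] [Fintype κ]
    {b₀ : ι → Γ(E, chartZero K)} {b₁ : κ → Γ(E, chartOne K)} (h₀ : IsFrame E _ b₀)
    (h₁ : IsFrame E _ b₁) : Fintype.card ι = Fintype.card κ := by
  obtain ⟨x, hx⟩ := exists_mem_overlap K
  exact (h₀.restrict inf_le_left).card_eq (h₁.restrict inf_le_right) x hx

theorem exists_hasRankDegree (hE : IsLocallyFreeFiniteRank E) :
    ∃ n δ, HasRankDegree E n δ := by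
  obtain ⟨n, b₀, h₀⟩ := exists_isFrame (isAffineOpen_chartZero K) hE
  obtain ⟨m, b₁, h₁⟩ := exists_isFrame (isAffineOpen_chartOne K) hE
  obtain rfl : n = m := by simpa using h₀.card_eq_of_overlap h₁
  obtain ⟨g, hg⟩ := (h₁.restrict (inf_le_right : chartZero K ⊓ chartOne K ≤ _)).exists_transition
    fun i => rs E inf_le_left (b₀ i)
  obtain ⟨δ, hδ⟩ := exists_isMonomial
    ((h₁.restrict inf_le_right).isUnit_det (h₀.restrict inf_le_left) hg)
  exact ⟨n, δ, b₀, b₁, g, h₀, h₁, hg, hδ⟩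

theorem hasRank_of_frames {b₀ : Fin n → Γ(E, chartZero K)} {b₁ : Fin n → Γ(E, chartOne K)}
    (h₀ : IsFrame E _ b₀) (h₁ : IsFrame E _ b₁) : HasRank E n := by
  intro x
  rw [hasRankAt_iff]
  rcases top_le_chart_sup K (Opens.mem_top x) with hx | hx
  · exact ⟨_, hx, b₀, h₀⟩
  · exact ⟨_, hx, b₁, h₁⟩

theorem HasRankDegree.hasRank (h : HasRankDegree E n δ) : HasRank E n := by
  obtain ⟨_, _, _, h₀, h₁, -⟩ := h
  exact hasRank_of_frames h₀ h₁

theorem HasRankDegree.rank_eq (h : HasRankDegree E n δ) (h' : HasRank E n') : n = n' := by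
  obtain ⟨b₀, b₁, g, h₀, -⟩ := h
  obtain ⟨x, hx⟩ := exists_mem_overlap K
  obtain ⟨U, hxU, b, hb⟩ := hasRankAt_iff.1 (h' x)
  simpa using (h₀.restrict (inf_le_right : U ⊓ chartZero K ≤ _)).card_eq
    (hb.restrict inf_le_left) x ⟨hxU, hx.1⟩

/-- The two transition matrices satisfy `g A₀ = A₁ g'`, where `A₀` and `A₁` change frames on the
charts and have constant determinants. -/
theorem HasRankDegree.degree_eq (h : HasRankDegree E n δ) (h' : HasRankDegree E n δ') :
    δ = δ' := by
  obtain ⟨b₀, b₁, g, h₀, h₁, hg, hδ⟩ := h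
  obtain ⟨c₀, c₁, g', h₀', h₁', hg', hδ'⟩ := h'
  obtain ⟨A₀, hA₀⟩ := h₀.exists_transition c₀
  obtain ⟨A₁, hA₁⟩ := h₁.exists_transition c₁
  have e := (hg.mul (hA₀.restrict inf_le_left)).unique (h₁.restrict inf_le_right)
    ((hA₁.restrict inf_le_right).mul hg')
  have e' := congrArg Matrix.det e
  have m₀ := isMonomial_of_isUnit_zero (h₀.isUnit_det h₀' hA₀)
  have m₁ := isMonomial_of_isUnit_one (h₁.isUnit_det h₁' hA₁)
  rw [RingHom.map_det, RingHom.mapMatrix_apply] at m₀ m₁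
  rw [Matrix.det_mul, Matrix.det_mul] at e'
  have := (hδ.mul m₀).unique (e' ▸ m₁.mul hδ')
  omega

theorem HasRankDegree.map_iso (h : HasRankDegree E n δ) (e : E ≅ F) : HasRankDegree F n δ := by
  obtain ⟨b₀, b₁, g, h₀, h₁, hg, hδ⟩ := h
  refine ⟨_, _, g, h₀.map_iso e, h₁.map_iso e, ?_, hδ⟩
  simpa only [app_rs] using hg.map e.hom

/-- Rank and degree are additive in short exact sequences. -/
theorem HasRankDegree.add {S : ShortComplex (P1 K).Modules} (hS : S.ShortExact)
    (hE : IsLocallyFreeFiniteRank S.X₂) (hE' : IsLocallyFreeFiniteRank S.X₃)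
    (h : HasRankDegree S.X₁ n δ) (h' : HasRankDegree S.X₃ n' δ') :
    HasRankDegree S.X₂ (n + n') (δ + δ') := by
  obtain ⟨b₀, b₁, g, h₀, h₁, hg, hδ⟩ := h
  obtain ⟨c₀, c₁, g', h₀', h₁', hg', hδ'⟩ := h'
  have := hS.epi_g
  have hs₀ := app_surjective_of_epi (isAffineOpen_chartZero K) S.g (.restrict _ hE _)
    (.restrict _ hE' _)
  have hs₁ := app_surjective_of_epi (isAffineOpen_chartOne K) S.g (.restrict _ hE _)
    (.restrict _ hE' _)
  -- The frames of the quotient lift because sections over an affine chart map surjectively.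
  choose l₀ hl₀ using fun i => hs₀ (c₀ i)
  choose l₁ hl₁ using fun i => hs₁ (c₁ i)
  obtain rfl : (fun i => S.g.app _ (l₀ i)) = c₀ := funext hl₀
  obtain rfl : (fun i => S.g.app _ (l₁ i)) = c₁ := funext hl₁
  have k₀ := isFrame_of_shortExact hS h₀ l₀ h₀'
  have k₁ := isFrame_of_shortExact hS h₁ l₁ h₁'
  obtain ⟨G, hG⟩ := (k₁.restrict (inf_le_right : chartZero K ⊓ chartOne K ≤ _)).exists_transition
    fun i => rs S.X₂ inf_le_left (Sum.elim (fun i => S.f.app (chartZero K) (b₀ i)) l₀ i)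
  -- Images of the sub involve only the sub's frame, with matrix `g`; modulo the sub, the lifts
  -- transform by `g'`. The upper right block is arbitrary and does not affect the determinant.
  have hG' : G = Matrix.fromBlocks g G.toBlocks₁₂ 0 g' := by
    have hfg : ∀ (U : (P1 K).Opens) (t : Γ(S.X₁, U)), S.g.app U (S.f.app U t) = 0 := by
      intro U t
      rw [← ConcreteCategory.comp_apply, ← Scheme.Modules.Hom.comp_app, S.zero]
      rfl
    have hinl : ∀ k, (fun i => G i (.inl k)) = Sum.elim (fun i => g i k) 0 := by
      intro k
      refine k₁.coord_ext inf_le_right ((hG (.inl k)).symm.trans ?_)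
      have := congrArg (S.f.app _) (hg k)
      rw [app_sum] at this
      simpa [app_rs] using this
    have hinr : G.toBlocks₂₂ = g' := by
      refine IsTransition.unique (h₁'.restrict inf_le_right) (fun k => ?_) hg'
      have := congrArg (S.g.app _) (hG (.inr k))
      rw [app_sum] at this
      simpa [app_rs, hfg, Matrix.toBlocks₂₂] using this
    ext (i | i) (k | k)
    · exact congrFun (hinl k) (.inl i)
    · rfl
    · exact congrFun (hinl k) (.inr i)
    · exact congrFun (congrFun hinr i) k
  refine hasRankDegree_of_frames k₀ k₁ hG ?_ (by simp)
  rw [hG', Matrix.det_fromBlocks_zero₂₁]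
  exact hδ.mul hδ'

variable (K) in
theorem hasRankDegree_splitBundle {e : ℕ} (d : Fin e → ℤ) :
    HasRankDegree (splitBundle K d) e (∑ i, d i) := by
  refine ⟨_, _, Matrix.diagonal fun i => (coordOverlap K).symm (LaurentPolynomial.T (d i)),
    isFrame_biproduct _ _ fun i => isFrame_powZero K (d i),
    isFrame_biproduct _ _ fun i => isFrame_powOne K (d i),
    fun k => ?_, ?_⟩
  · rw [Finset.sum_eq_single k]
    · simp only [Matrix.diagonal_apply_eq]
      rw [← app_rs, ← app_rs, rs_powZero,
        Scheme.Modules.Hom.app_smul]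
    · intro i _ hik
      rw [Matrix.diagonal_apply_ne _ hik, zero_smul]
    · simp
  · rw [Matrix.det_diagonal]
    exact IsMonomial.prod _ fun i => isMonomial_symm_T (d i)

end Degree

/-! ### Line subbundles with locally free quotient -/

section SubLine

variable {K : Type u} [Field K]

theorem HasRank.isLocallyFree {X : Scheme.{u}} {E : X.Modules} {n : ℕ} (h : HasRank E n) :
    IsLocallyFreeFiniteRank E := fun x => ⟨n, h x⟩

variable (K) in
theorem hasRankDegree_O (d : ℤ) : HasRankDegree (O K d) 1 d :=
  hasRankDegree_of_frames (isFrame_powZero K d) (isFrame_powOne K d)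
    (g := Matrix.of fun _ _ => (coordOverlap K).symm (LaurentPolynomial.T d))
    (fun _ => by simp [rs_powZero]) (by rw [Matrix.det_unique]; exact isMonomial_symm_T d) (by simp)

variable (K) in
/-- The line bundle `𝒪(d)` as a vector bundle. -/
def lineBundle (d : ℤ) : VectorBundle (P1 K) :=
  ⟨O K d, (hasRankDegree_O K d).hasRank.isLocallyFree⟩

/-- The equivalence singling out the first index. -/
def unitSumFinEquiv (n : ℕ) : Unit ⊕ Fin n ≃ Fin (n + 1) :=
  ((Equiv.sumComm _ _).trans (Equiv.optionEquivSumPUnit.{0} (Fin n)).symm).trans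
    (finSuccEquiv n).symm

theorem unitSumFinEquiv_eq {n : ℕ} {α : Type*} (b : Fin (n + 1) → α) :
    (fun i => b (unitSumFinEquiv n i)) = Sum.elim (fun _ => b 0) fun i => b i.succ := by
  funext i
  rcases i with i | i <;> simp [unitSumFinEquiv]

theorem KGroup.of_eq_add {X : Scheme.{u}} {E' E E'' : VectorBundle X} {i : E'.sheaf ⟶ E.sheaf}
    {p : E.sheaf ⟶ E''.sheaf} {w : i ≫ p = 0} (h : (ShortComplex.mk i p w).ShortExact) :
    KGroup.of E = KGroup.of E' + KGroup.of E'' := by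
  have : FreeAbelianGroup.of E - FreeAbelianGroup.of E' - FreeAbelianGroup.of E'' ∈
      exactRelations X := AddSubgroup.subset_closure ⟨E', E, E'', i, p, w, h, rfl⟩
  have h2 := (QuotientAddGroup.eq_zero_iff _).2 this
  rw [QuotientAddGroup.mk_sub, QuotientAddGroup.mk_sub, sub_sub, sub_eq_zero] at h2
  exact h2

variable {E : VectorBundle (P1 K)} {n : ℕ} {d δ : ℤ}

/-- The first frame members satisfy the transition rule of `𝒪(d)`, so they define a morphism from
`𝒪(d)`; the remaining members give frames of its cokernel. -/
theorem exists_quotient_of_frames {b₀ : Fin (n + 1) → Γ(E.sheaf, chartZero K)}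
    {b₁ : Fin (n + 1) → Γ(E.sheaf, chartOne K)} (h₀ : IsFrame E.sheaf _ b₀)
    (h₁ : IsFrame E.sheaf _ b₁) (hE : HasRankDegree E.sheaf (n + 1) δ)
    (h : rs E.sheaf (inf_le_left : chartZero K ⊓ chartOne K ≤ _) (b₀ 0) =
      (coordOverlap K).symm (LaurentPolynomial.T d) • rs E.sheaf inf_le_right (b₁ 0)) :
    ∃ Q : VectorBundle (P1 K), HasRankDegree Q.sheaf n (δ - d) ∧
      KGroup.of E = KGroup.of (lineBundle K d) + KGroup.of Q := by
  obtain ⟨φ, hφ₀, hφ₁⟩ := exists_hom_of_frames (M := E.sheaf) (top_le_chart_sup K)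
    (isFrame_powZero K d) (isFrame_powOne K d) (fun _ => b₀ 0) (fun _ => b₁ 0)
    (fun _ _ => (coordOverlap K).symm (LaurentPolynomial.T d)) (fun _ => by simp [rs_powZero])
    (fun _ => by simp [h])
  replace hφ₀ := hφ₀ ()
  replace hφ₁ := hφ₁ ()
  have k₀ := h₀.reindex (unitSumFinEquiv n)
  have k₁ := h₁.reindex (unitSumFinEquiv n)
  rw [unitSumFinEquiv_eq, ← hφ₀] at k₀
  rw [unitSumFinEquiv_eq, ← hφ₁] at k₁
  -- Below a chart, `φ` sends the generator of `𝒪(d)` to a frame member, so no nonzero multiple of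
  -- the generator is killed.
  have inj : ∀ {U : (P1 K).Opens} {e : Γ(O K d, U)} (_ : IsFrame (O K d) U fun _ : Unit => e)
      {c : Fin n → Γ(E.sheaf, U)} (_ : IsFrame E.sheaf U (Sum.elim (fun _ : Unit => φ.app U e) c))
      (W : (P1 K).Opens) (_ : W ≤ U), Function.Injective (φ.app W) := by
    intro U e he c hc W hW
    rw [injective_iff_map_eq_zero]
    intro s hs
    obtain ⟨a, rfl⟩ := he.exists_coord hW s
    rw [app_sum] at hs
    have := hc.coord_ext hW (a := Sum.elim a 0) (a' := 0) (by simpa [app_rs] using hs)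
    simp [show a = 0 from funext fun i => congrFun this (.inl i)]
  have hmono : Mono φ := by
    refine mono_of_injective φ fun W s t hst => ?_
    refine eq_of_pair (le_top.trans (top_le_chart_sup K) : W ≤ _)
      (inj (isFrame_powZero K d) k₀ _ inf_le_right ?_)
      (inj (isFrame_powOne K d) k₁ _ inf_le_right ?_)
    · rw [app_rs, app_rs, hst]
    · rw [app_rs, app_rs, hst]
  have hS : (ShortComplex.mk φ (cokernel.π φ) (cokernel.condition φ)).ShortExact :=
    { exact := ShortComplex.exact_cokernel φ
      mono_f := hmono
      epi_g := inferInstance }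
  have hL := (lineBundle K d).isLocallyFree
  -- `bijective_quotient` yields a basis over the chart only; it is a frame because the cokernel is
  -- associated with a module there.
  have f₀ := isFrame_of_bijective (isAffineOpen_chartZero K)
    (IsTilde.restrict_cokernel hL E.isLocallyFree φ _) _
    (bijective_quotient hS (isFrame_powZero K d) _ k₀ (app_surjective_of_epi
      (isAffineOpen_chartZero K) (cokernel.π φ) (.restrict _ E.isLocallyFree _)
      (IsTilde.restrict_cokernel hL E.isLocallyFree φ _)))
  have f₁ := isFrame_of_bijective (isAffineOpen_chartOne K)
    (IsTilde.restrict_cokernel hL E.isLocallyFree φ _) _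
    (bijective_quotient hS (isFrame_powOne K d) _ k₁ (app_surjective_of_epi
      (isAffineOpen_chartOne K) (cokernel.π φ) (.restrict _ E.isLocallyFree _)
      (IsTilde.restrict_cokernel hL E.isLocallyFree φ _)))
  have hr : HasRank (cokernel φ) n := hasRank_of_frames f₀ f₁
  let Q : VectorBundle (P1 K) := ⟨cokernel φ, hr.isLocallyFree⟩
  refine ⟨Q, ?_, KGroup.of_eq_add (E' := lineBundle K d) (E'' := Q) hS⟩
  -- The quotient has some degree; additivity and uniqueness of the degree force it to be `δ - d`.
  obtain ⟨n', δ', hQ⟩ := exists_hasRankDegree Q.isLocallyFree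
  obtain rfl := hQ.rank_eq hr
  have := HasRankDegree.add hS E.isLocallyFree Q.isLocallyFree (hasRankDegree_O K d) hQ
  rw [add_comm 1] at this
  rwa [hE.degree_eq this, add_sub_cancel_left]

/-- Finitely many Laurent polynomials become polynomials after multiplication by a common power of
`T`; the sum of the individual exponents serves for all. -/
theorem exists_coordOne_eq {ι : Type*} [Fintype ι] (a : ι → Γ(P1 K, chartZero K ⊓ chartOne K)) :
    ∃ (N : ℕ) (w : ι → Γ(P1 K, chartOne K)), ∀ i,
      ro inf_le_right (w i) = (coordOverlap K).symm (LaurentPolynomial.T N) * a i := by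
  choose N p hp using fun i => (coordOverlap K (a i)).exists_T_pow
  refine ⟨∑ i, N i, fun i => (coordOne K).symm (Polynomial.X ^ (∑ i, N i - N i) * p i),
    fun i => ?_⟩
  apply (coordOverlap K).injective
  have hle : N i ≤ ∑ i, N i := Finset.single_le_sum (fun _ _ => Nat.zero_le _) (Finset.mem_univ i)
  rw [coordOverlap_one, RingEquiv.apply_symm_apply, map_mul, map_mul, RingEquiv.apply_symm_apply,
    Polynomial.toLaurent_X_pow, hp, Nat.cast_sub hle, LaurentPolynomial.T_sub]
  have : (LaurentPolynomial.T (-(N i : ℤ)) * LaurentPolynomial.T (N i) :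
      LaurentPolynomial K) = 1 := by
    rw [← LaurentPolynomial.T_add, neg_add_cancel, LaurentPolynomial.T_zero]
  linear_combination (LaurentPolynomial.T ((∑ i, N i : ℕ) : ℤ) * coordOverlap K (a i)) * this

/-- A nonzero vector in a free module over a principal ideal domain is a multiple of a member of a
basis. -/
theorem exists_basis_smul_eq {R M : Type*} [CommRing R] [IsDomain R] [IsPrincipalIdealRing R]
    [AddCommGroup M] [Module R M] {n : ℕ} (b : Module.Basis (Fin (n + 1)) R M) {w : M}
    (hw : w ≠ 0) : ∃ (c : Module.Basis (Fin (n + 1)) R M) (r : R), w = r • c 0 := by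
  obtain ⟨m, c, bN, f, a, h⟩ := (Submodule.span R {w}).smithNormalForm b
  have := Module.Free.of_basis b
  -- The span of a nonzero vector is free of rank one, so its Smith normal form has a single entry.
  have hm : m = 1 := by
    have := Fintype.card_congr
      (bN.indexEquiv ((Module.Basis.singleton Unit R).map
        (LinearEquiv.toSpanNonzeroSingleton R M w hw)))
    simpa using this
  subst hm
  have h1 := bN.sum_repr ⟨w, Submodule.mem_span_singleton_self w⟩
  have h2 := congrArg Subtype.val h1
  simp only [Finset.univ_unique, Finset.sum_singleton, Submodule.coe_smul, h, smul_smul] at h2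
  exact ⟨c.reindex (Equiv.swap (f default) 0), _, by simpa using h2.symm⟩

theorem IsFrame.smul {X : Scheme.{u}} {M : X.Modules} {U : X.Opens} {ι : Type*} [Fintype ι]
    {b : ι → Γ(M, U)} (hb : IsFrame M U b) {r : Γ(X, U)} (hr : IsUnit r) :
    IsFrame M U fun i => r • b i := by
  classical
  obtain ⟨r', hr'⟩ := isUnit_iff_exists_inv.1 hr
  refine hb.of_transition (A := Matrix.diagonal fun _ => r) (B := Matrix.diagonal fun _ => r')
    (fun k => ?_) (fun k => ?_) ?_
  · simp [Matrix.diagonal_apply]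
  · simp [Matrix.diagonal_apply, smul_smul, mul_comm r', hr']
  · simp [mul_comm r', hr']

/-- A vector bundle of positive rank has frames over the standard charts whose first members span a
twisting sheaf. -/
theorem exists_adapted_frames (hE : HasRankDegree E.sheaf (n + 1) δ) :
    ∃ (d : ℤ) (b₀ : Fin (n + 1) → Γ(E.sheaf, chartZero K))
      (b₁ : Fin (n + 1) → Γ(E.sheaf, chartOne K)), IsFrame E.sheaf _ b₀ ∧ IsFrame E.sheaf _ b₁ ∧
      rs E.sheaf (inf_le_left : chartZero K ⊓ chartOne K ≤ _) (b₀ 0) =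
      (coordOverlap K).symm (LaurentPolynomial.T d) • rs E.sheaf inf_le_right (b₁ 0) := by
  obtain ⟨b₀, b₁, -, h₀, h₁, -⟩ := hE
  obtain ⟨a, ha⟩ := h₁.exists_coord (inf_le_right : chartZero K ⊓ chartOne K ≤ _)
    (rs E.sheaf inf_le_left (b₀ 0))
  -- `t ^ N b₀ 0` extends from the overlap to the section `∑ w i • b₁ i` over the chart `x₁ ≠ 0`.
  obtain ⟨N, w, hw⟩ := exists_coordOne_eq a
  have hT : IsUnit ((coordOverlap K).symm (LaurentPolynomial.T N)) :=
    (LaurentPolynomial.isUnit_T _).map _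
  have hsum : rs E.sheaf inf_le_right (∑ i, w i • b₁ i) =
      (coordOverlap K).symm (LaurentPolynomial.T N) • rs E.sheaf inf_le_left (b₀ 0) := by
    rw [rs_sum_smul, ha, Finset.smul_sum]
    simp_rw [hw, smul_smul]
  -- A member of a frame is divisible only by units.
  have key : ∀ (f : Γ(P1 K, chartZero K ⊓ chartOne K)) (s : Γ(E.sheaf, chartZero K ⊓ chartOne K)),
      rs E.sheaf inf_le_left (b₀ 0) = f • s → IsUnit f := by
    intro f s hs
    obtain ⟨c, rfl⟩ := h₀.exists_coord inf_le_left s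
    have := h₀.coord_ext inf_le_left (a := Pi.single 0 1) (a' := fun i => f * c i) (by
      rw [Finset.smul_sum] at hs
      simp_rw [smul_smul] at hs
      rw [← hs]
      simp [Pi.single_apply])
    exact IsUnit.of_mul_eq_one (c 0) (by simpa using (congrFun this 0).symm)
  have hne : ∑ i, w i • b₁ i ≠ 0 := by
    intro h
    rw [h, map_zero] at hsum
    have h2 : rs E.sheaf (inf_le_left : chartZero K ⊓ chartOne K ≤ _) (b₀ 0) =
        (0 : Γ(P1 K, chartZero K ⊓ chartOne K)) • rs E.sheaf inf_le_left (b₀ 0) := by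
      rw [zero_smul]
      exact hT.smul_eq_zero.1 hsum.symm
    have h3 := (key _ _ h2).map (coordOverlap K)
    rw [map_zero] at h3
    exact not_isUnit_zero h3
  -- Dividing the extended section by `r` makes it part of a basis. On the overlap the factor
  -- relating it to `b₀ 0` is a unit by `key`, hence a monomial `κ t ^ d`.
  obtain ⟨c, r, hr⟩ := exists_basis_smul_eq h₁.basis hne
  rw [hr, rs_smul] at hsum
  obtain ⟨T', hT'⟩ := hT.exists_left_inv
  have hu : rs E.sheaf inf_le_left (b₀ 0) =
      (T' * ro inf_le_right r) • rs E.sheaf inf_le_right (c 0) := by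
    rw [mul_smul, hsum, smul_smul, hT', one_smul]
  obtain ⟨d, κ, hκ, hd⟩ := exists_isMonomial (key _ _ hu)
  have hκ' : IsUnit ((coordOne K).symm (Polynomial.C κ)) :=
    (Polynomial.isUnit_C.2 hκ.isUnit).map _
  -- The constant `κ` is absorbed by rescaling the whole second frame.
  refine ⟨d, b₀, _, h₀, (h₁.of_basis c).smul hκ', ?_⟩
  rw [hu, rs_smul, smul_smul]
  congr 1
  apply (coordOverlap K).injective
  rw [hd, map_mul, RingEquiv.apply_symm_apply, coordOverlap_one, RingEquiv.apply_symm_apply,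
    Polynomial.toLaurent_C, mul_comm]

theorem exists_quotient (hE : HasRankDegree E.sheaf (n + 1) δ) :
    ∃ (d : ℤ) (Q : VectorBundle (P1 K)), HasRankDegree Q.sheaf n (δ - d) ∧
      KGroup.of E = KGroup.of (lineBundle K d) + KGroup.of Q := by
  obtain ⟨d, b₀, b₁, h₀, h₁, h⟩ := exists_adapted_frames hE
  exact ⟨d, exists_quotient_of_frames h₀ h₁ hE h⟩

end SubLine

/-! ### Generators and relations of the Grothendieck group -/

section KGroup

variable {K : Type u} [Field K] {E : VectorBundle (P1 K)} {n : ℕ} {δ : ℤ}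

theorem HasRankDegree.degree_eq_zero (h : HasRankDegree E.sheaf 0 δ) : δ = 0 := by
  obtain ⟨-, -, g, -, -, -, hδ⟩ := h
  rw [Matrix.det_isEmpty] at hδ
  exact hδ.unique isMonomial_one

/-- A bundle with empty frames is zero, so `E ⟶ E ⟶ E` with maps `𝟙` and `0` is short exact and
gives `[E] = [E] + [E]`. -/
theorem KGroup.of_eq_zero (h : HasRankDegree E.sheaf 0 δ) : KGroup.of E = 0 := by
  obtain ⟨b₀, b₁, g, h₀, h₁, -⟩ := h
  have hsub : ∀ (U : (P1 K).Opens) (s : Γ(E.sheaf, U)), s = 0 := by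
    intro U s
    refine eq_of_pair (le_top.trans (top_le_chart_sup K) : U ≤ _) ?_ ?_
    · obtain ⟨a, ha⟩ := h₀.exists_coord (inf_le_right : U ⊓ _ ≤ _) (rs E.sheaf inf_le_left s)
      simpa using ha
    · obtain ⟨a, ha⟩ := h₁.exists_coord (inf_le_right : U ⊓ _ ≤ _) (rs E.sheaf inf_le_left s)
      simpa using ha
  have hiso : IsIso (0 : E.sheaf ⟶ E.sheaf) := isIso_of_bijective _ fun U =>
    ⟨fun s t _ => (hsub U s).trans (hsub U t).symm, fun s =>
      ⟨s, (hsub U _).trans (hsub U s).symm⟩⟩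
  have hz : IsZero E.sheaf := by
    rw [IsZero.iff_id_eq_zero, ← IsIso.hom_inv_id (0 : E.sheaf ⟶ E.sheaf), zero_comp]
  have hS : (ShortComplex.mk (𝟙 E.sheaf) (0 : E.sheaf ⟶ E.sheaf) comp_zero).ShortExact :=
    { exact := ShortComplex.exact_of_isZero_X₂ _ hz
      mono_f := inferInstanceAs (Mono (𝟙 E.sheaf))
      epi_g := inferInstanceAs (Epi (0 : E.sheaf ⟶ E.sheaf)) }
  simpa using KGroup.of_eq_add hS

/-- The quotient by the subsheaf `𝒪(d)` has rank zero, so its class and its degree `δ - d` both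
vanish. -/
theorem KGroup.of_eq_lineBundle (h : HasRankDegree E.sheaf 1 δ) :
    KGroup.of E = KGroup.of (lineBundle K δ) := by
  obtain ⟨d, Q, hQ, hE⟩ := exists_quotient h
  have := hQ.degree_eq_zero
  rw [hE, KGroup.of_eq_zero hQ, add_zero, sub_eq_zero.1 this]

/-- The relation between the classes of twisting sheaves given by the two embeddings of twisting
sheaves in `𝒪(d + 1) ⊕ 𝒪(d + 1)`. -/
theorem lineBundle_relation (d : ℤ) :
    KGroup.of (lineBundle K d) + KGroup.of (lineBundle K (d + 2)) =
    KGroup.of (lineBundle K (d + 1)) + KGroup.of (lineBundle K (d + 1)) := by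
  have hE := hasRankDegree_splitBundle K fun _ : Fin 2 => d + 1
  let E : VectorBundle (P1 K) := ⟨_, hE.hasRank.isLocallyFree⟩
  have hE' : HasRankDegree E.sheaf (1 + 1) (2 * (d + 1)) := by simpa using hE
  obtain ⟨b₀, b₁, h₀, h₁, hb⟩ : ∃ (b₀ : Fin 2 → Γ(E.sheaf, chartZero K))
      (b₁ : Fin 2 → Γ(E.sheaf, chartOne K)), IsFrame E.sheaf _ b₀ ∧ IsFrame E.sheaf _ b₁ ∧
      ∀ k, rs E.sheaf (inf_le_left : chartZero K ⊓ chartOne K ≤ _) (b₀ k) =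
        (coordOverlap K).symm (LaurentPolynomial.T (d + 1)) • rs E.sheaf inf_le_right (b₁ k) := by
    refine ⟨_, _, isFrame_biproduct _ _ fun _ => isFrame_powZero K (d + 1),
      isFrame_biproduct _ _ fun _ => isFrame_powOne K (d + 1), fun k => ?_⟩
    rw [← app_rs, ← app_rs, rs_powZero, Scheme.Modules.Hom.app_smul]
  have r₁ : KGroup.of E = KGroup.of (lineBundle K (d + 1)) + KGroup.of (lineBundle K (d + 1)) := by
    -- The first summand is the sub; the quotient has degree `2 (d + 1) - (d + 1)`.
    obtain ⟨Q, hQ, h⟩ := exists_quotient_of_frames h₀ h₁ hE' (hb 0)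
    rw [h, KGroup.of_eq_lineBundle hQ]
    congr 3
    ring
  have r₂ : KGroup.of E = KGroup.of (lineBundle K d) + KGroup.of (lineBundle K (d + 2)) := by
    let s := (coordZero K).symm Polynomial.X
    let t := (coordOne K).symm Polynomial.X
    have hs : ro (inf_le_left : chartZero K ⊓ chartOne K ≤ _) s =
        (coordOverlap K).symm (LaurentPolynomial.T (-1)) := by
      apply (coordOverlap K).injective
      simp [s, coordOverlap_zero]
    have ht : ro (inf_le_right : chartZero K ⊓ chartOne K ≤ _) t =
        (coordOverlap K).symm (LaurentPolynomial.T 1) := by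
      apply (coordOverlap K).injective
      simp [t, coordOverlap_one]
    -- With `s = t⁻¹` on the overlap, `b₀ 0 + s b₀ 1 = t ^ d (t b₁ 0 + b₁ 1)`, so these first
    -- members span a copy of `𝒪(d)`, embedded by `(x₀, x₁)`.
    have k₀ : IsFrame E.sheaf _ ![b₀ 0 + s • b₀ 1, b₀ 1] := by
      refine h₀.of_transition (A := !![1, 0; s, 1]) (B := !![1, 0; -s, 1]) (fun k => ?_)
        (fun k => ?_) ?_
      · fin_cases k <;> simp
      · fin_cases k <;> simp
      · simp [Matrix.one_fin_two]
    have k₁ : IsFrame E.sheaf _ ![t • b₁ 0 + b₁ 1, b₁ 0] := by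
      refine h₁.of_transition (A := !![t, 1; 1, 0]) (B := !![0, 1; 1, -t]) (fun k => ?_)
        (fun k => ?_) ?_
      · fin_cases k <;> simp
      · fin_cases k <;> simp
      · simp [Matrix.one_fin_two]
    obtain ⟨Q, hQ, h⟩ := exists_quotient_of_frames (d := d) k₀ k₁ hE' (by
      have e₁ : (coordOverlap K).symm (LaurentPolynomial.T (d + 1)) =
          (coordOverlap K).symm (LaurentPolynomial.T d) *
            (coordOverlap K).symm (LaurentPolynomial.T 1) := by
        rw [← map_mul, ← LaurentPolynomial.T_add]
      have e₂ : (coordOverlap K).symm (LaurentPolynomial.T (-1)) *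
          (coordOverlap K).symm (LaurentPolynomial.T (d + 1)) =
          (coordOverlap K).symm (LaurentPolynomial.T d) := by
        rw [← map_mul, ← LaurentPolynomial.T_add, add_comm d, neg_add_cancel_left]
      simp only [Matrix.cons_val_zero, map_add, rs_smul, hb, hs, ht, smul_add, smul_smul, e₂, ← e₁])
    rw [h, KGroup.of_eq_lineBundle hQ]
    congr 3
    ring
  rw [← r₁, r₂]

/-- By `lineBundle_relation` the second differences of `d ↦ [𝒪(d)]` vanish, so the sequence is an
arithmetic progression in both directions. -/
theorem KGroup.of_lineBundle (d : ℤ) : KGroup.of (lineBundle K d) =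
    KGroup.of (lineBundle K 0) +
      d • (KGroup.of (lineBundle K 1) - KGroup.of (lineBundle K 0)) := by
  have h : ∀ d : ℤ, KGroup.of (lineBundle K (d + 1)) - KGroup.of (lineBundle K d) =
      KGroup.of (lineBundle K 1) - KGroup.of (lineBundle K 0) := by
    have step : ∀ d : ℤ, KGroup.of (lineBundle K (d + 2)) - KGroup.of (lineBundle K (d + 1)) =
        KGroup.of (lineBundle K (d + 1)) - KGroup.of (lineBundle K d) := by
      intro d
      rw [sub_eq_sub_iff_add_eq_add, add_comm]
      exact lineBundle_relation d
    intro d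
    induction d using Int.induction_on with
    | zero => simp
    | succ d ih => rw [← ih, ← step d, add_assoc]; rfl
    | pred d ih =>
      rw [← ih, ← step (-d - 1)]
      congr 3 <;> ring
  induction d using Int.induction_on with
  | zero => simp
  | succ d ih => rw [← sub_add_cancel (KGroup.of (lineBundle K (d + 1))), h, ih, add_smul]; abel
  | pred d ih =>
    have e : KGroup.of (lineBundle K (-d - 1)) = KGroup.of (lineBundle K (-d)) -
        (KGroup.of (lineBundle K 1) - KGroup.of (lineBundle K 0)) := by
      rw [← h (-d - 1), sub_add_cancel, sub_sub_cancel]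
    rw [e, ih, sub_smul, one_smul, add_sub_assoc]

/-- Induction on the rank, splitting off one `𝒪(d)` at a time in the Grothendieck group. -/
theorem KGroup.of_eq (h : HasRankDegree E.sheaf n δ) : KGroup.of E =
    n • KGroup.of (lineBundle K 0) +
      δ • (KGroup.of (lineBundle K 1) - KGroup.of (lineBundle K 0)) := by
  induction n generalizing E δ with
  | zero => simp [KGroup.of_eq_zero h, h.degree_eq_zero]
  | succ n ih =>
    obtain ⟨d, Q, hQ, hE⟩ := exists_quotient h
    rw [hE, ih hQ, KGroup.of_lineBundle d, sub_smul, add_smul n, one_smul]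
    abel

/-- The degree and the rank of a vector bundle on the projective line. -/
def degreeRank (E : VectorBundle (P1 K)) : ℤ × ℤ :=
  ((exists_hasRankDegree E.isLocallyFree).choose_spec.choose,
    (exists_hasRankDegree E.isLocallyFree).choose)

theorem HasRankDegree.degreeRank_eq (h : HasRankDegree E.sheaf n δ) :
    degreeRank E = (δ, (n : ℤ)) := by
  have key : ∀ {n' : ℕ} {δ' : ℤ}, HasRankDegree E.sheaf n' δ' → (δ', (n' : ℤ)) = (δ, (n : ℤ)) := by
    intro n' δ' h'
    obtain rfl := h'.rank_eq h.hasRank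
    rw [h'.degree_eq h]
  exact key (exists_hasRankDegree E.isLocallyFree).choose_spec.choose_spec

variable (K) in
/-- The degree and the rank on the Grothendieck group. -/
def degreeRankHom : KGroup (P1 K) →+ ℤ × ℤ :=
  QuotientAddGroup.lift _ (FreeAbelianGroup.lift degreeRank) <| by
    rw [exactRelations, AddSubgroup.closure_le]
    rintro _ ⟨E', E, E'', i, p, w, hS, rfl⟩
    obtain ⟨n', δ', h'⟩ := exists_hasRankDegree E'.isLocallyFree
    obtain ⟨n'', δ'', h''⟩ := exists_hasRankDegree E''.isLocallyFree
    have h : HasRankDegree E.sheaf _ _ :=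
      HasRankDegree.add hS E.isLocallyFree E''.isLocallyFree h' h''
    simp [h.degreeRank_eq, h'.degreeRank_eq, h''.degreeRank_eq]

theorem degreeRankHom_of (h : HasRankDegree E.sheaf n δ) :
    degreeRankHom K (KGroup.of E) = (δ, (n : ℤ)) :=
  (FreeAbelianGroup.lift_apply_of degreeRank E).trans h.degreeRank_eq

theorem degreeRankHom_lineBundle (d : ℤ) :
    degreeRankHom K (KGroup.of (lineBundle K d)) = (d, 1) :=
  degreeRankHom_of (hasRankDegree_O K d)

variable (K) in
theorem hasDegree_O (d : ℤ) : HasDegree (O K d) d :=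
  ⟨1, fun _ => d, ⟨(biproductUniqueIso fun _ : Fin 1 => O K d).symm⟩, by simp⟩

theorem KGroup.induction {X : Scheme.{u}} {p : KGroup X → Prop} (x : KGroup X) (h0 : p 0)
    (hof : ∀ E, p (KGroup.of E)) (hneg : ∀ x, p x → p (-x)) (hadd : ∀ x y, p x → p y → p (x + y)) :
    p x := by
  induction x using QuotientAddGroup.induction_on with | _ z
  induction z using FreeAbelianGroup.induction_on with
  | zero => exact h0
  | of E => exact hof E
  | neg E h => exact hneg _ h
  | add x y hx hy => exact hadd _ _ hx hy

/-- Since `[𝒪]` and `[𝒪(1)] - [𝒪]` generate, rank and degree determine a class. Injectivity and the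
uniqueness of the isomorphism both rest on this. -/
theorem KGroup.eq_degreeRankHom (x : KGroup (P1 K)) :
    x = (degreeRankHom K x).2 • KGroup.of (lineBundle K 0) +
      (degreeRankHom K x).1 • (KGroup.of (lineBundle K 1) - KGroup.of (lineBundle K 0)) := by
  induction x using KGroup.induction with
  | h0 => simp
  | hof E =>
    obtain ⟨n, δ, h⟩ := exists_hasRankDegree E.isLocallyFree
    rw [degreeRankHom_of h, natCast_zsmul]
    exact KGroup.of_eq h
  | hneg x hx =>
    conv_lhs => rw [hx]
    simp only [map_neg, Prod.fst_neg, Prod.snd_neg, neg_smul]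
    abel
  | hadd x y hx hy =>
    conv_lhs => rw [hx, hy]
    simp only [map_add, Prod.fst_add, Prod.snd_add, add_smul]
    abel

variable (K) in
/-- The Grothendieck group of the projective line. -/
def degreeRankEquiv : KGroup (P1 K) ≃+ ℤ × ℤ where
  toFun := degreeRankHom K
  invFun z := z.2 • KGroup.of (lineBundle K 0) +
      z.1 • (KGroup.of (lineBundle K 1) - KGroup.of (lineBundle K 0))
  left_inv x := (KGroup.eq_degreeRankHom x).symm
  right_inv z := by
    simp [degreeRankHom_lineBundle]
  map_add' := map_add _

end KGroup

end KTheoryP1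

end

/-! ### The main theorem -/

theorem corollary4p2 (K : Type u) [Field K] [IsAlgClosed K] [CharZero K] :
    (∀ (e : ℕ) (d : Fin e → ℤ), KTheoryP1.HasRank (KTheoryP1.splitBundle K d) e) ∧
    ∃! φ : KTheoryP1.KGroup (KTheoryP1.P1 K) ≃+ ℤ × ℤ,
      (∀ (E : KTheoryP1.VectorBundle (KTheoryP1.P1 K)) (δ : ℤ) (r : ℕ),
        KTheoryP1.HasDegree E.sheaf δ → KTheoryP1.HasRank E.sheaf r →
          φ (KTheoryP1.KGroup.of E) = (δ, (r : ℤ))) ∧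
      (∀ (E : KTheoryP1.VectorBundle (KTheoryP1.P1 K)) (r : ℕ),
        KTheoryP1.HasRank E.sheaf r → (φ (KTheoryP1.KGroup.of E)).2 = (r : ℤ)) := by
  refine ⟨fun e d => (KTheoryP1.hasRankDegree_splitBundle K d).hasRank,
    KTheoryP1.degreeRankEquiv K, ⟨?_, ?_⟩, ?_⟩
  · rintro E δ r ⟨e, d, ⟨i⟩, rfl⟩ hr
    -- The degree read off from any splitting is the order of the transition determinant, so it is
    -- independent of the splitting.
    have h := (KTheoryP1.hasRankDegree_splitBundle K d).map_iso i.symm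
    obtain rfl := h.rank_eq hr
    exact KTheoryP1.degreeRankHom_of h
  · intro E r hr
    obtain ⟨n, δ, h⟩ := KTheoryP1.exists_hasRankDegree E.isLocallyFree
    obtain rfl := h.rank_eq hr
    exact congrArg Prod.snd (KTheoryP1.degreeRankHom_of h)
  · rintro φ ⟨hφ, -⟩
    -- The values on twisting sheaves are forced by the first property, and these classes generate
    -- the group.
    have hline : ∀ d, φ (KTheoryP1.KGroup.of (KTheoryP1.lineBundle K d)) = (d, 1) := by
      intro d
      refine hφ _ d 1 (KTheoryP1.hasDegree_O K d)
        (KTheoryP1.hasRankDegree_O K d).hasRank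
    ext1 x
    rw [KTheoryP1.KGroup.eq_degreeRankHom x]
    simp only [map_add, map_zsmul, map_sub, hline]
    exact (congrArg₂ (fun a b => _ • a + _ • (b - a)) (KTheoryP1.degreeRankHom_lineBundle 0)
      (KTheoryP1.degreeRankHom_lineBundle 1)).symm
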